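/- Let $U$ be a unitary operator on $\mathbb{C}^3$, let $\mathsf z\in\mathbb{C}^3$ be a unit vector, and consider the projective measurement $\Pi(\mathsf z)=\{\Pi_1,\Pi_2\}$, where $\Pi_2=\rho_{\mathsf z}$ is the orthogonal projection onto $\operatorname{span}\{\mathsf z\}$ and $\Pi_1=\mathbb{I}_3-\rho_{\mathsf z}$. Let $\mathcal F_{U,\Pi(\mathsf z)}$ be the partial iterated function system on the quantum states of $\mathbb{C}^3$ with probabilities $\mathsf p_i(\rho)=\operatorname{tr}(\Pi_iU\rho U^*)$ and evolution maps $\mathsf F_i(\rho)=\Pi_iU\rho U^*\Pi_i/\mathsf p_i(\rho)$, the latter being defined where $\mathsf p_i(\rho)>0$, $i\in\{1,2\}$. It generates a Markov chain (started at $\mathbb{I}_3/3$ and moving from $\rho$ to $\mathsf F_i(\rho)$ with probability $\mathsf p_i(\rho)$), whose type is defined as follows. Let $\lambda_1,\lambda_2$ with $|\lambda_2|\le|\lambda_1|$ be the eigenvalues, counted with multiplicity, of the operator $A=\Pi_1U|_\Theta$ on $\Theta=\operatorname{span}\{\mathsf z\}^\perp$, and, if both are non-zero, let $\psi=\operatorname{Arg}(\lambda_2/\lambda_1)$.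 The chain is called * unitary if $|\lambda_2|=|\lambda_1|=1$; * null if $\lambda_2=0$; more precisely, generic-null if moreover $0<|\lambda_1|<1$, double-null if $\lambda_1=0$, taupek-null if $|\lambda_1|=1$; * taupek if $0<|\lambda_2|<|\lambda_1|=1$; * finite-elliptic if $0<|\lambda_2|=|\lambda_1|<1$ and $\psi\in\pi\mathbb{Q}\setminus\{0\}$, and in particular circular if moreover $\psi=\pi$; * $\infty$-elliptic if $0<|\lambda_2|=|\lambda_1|<1$ and $\psi\notin\pi\mathbb{Q}$; * generic if $0<|\lambda_2|<|\lambda_1|<1$, or $\lambda_1=\lambda_2$ with $0<|\lambda_1|<1$. Let $\mathfrak W(U)=\{\langle z|Uz\rangle : \|z\|=1\}\subset\mathbb{C}$ be the numerical range of $U$, with interior $\operatorname{Int}\mathfrak W(U)$ and boundary $\partial\mathfrak W(U)$ taken in $\mathbb{C}$, let $\sigma(U)$ be the set of eigenvalues of $U$, and put $\omega=\langle\mathsf z|U\mathsf z\rangle\in\mathfrak W(U)$. **Theorem.** The Markov chain generated by $\mathcal F_{U,\Pi(\mathsf z)}$ is * unitary iff $\omega\in\sigma(U)$; * null iff $\omega=0$,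 and in that case it is * generic-null iff $\mathfrak W(U)$ is an acute non-equilateral triangle, * double-null iff $\mathfrak W(U)$ is an equilateral triangle, * taupek-null iff $\mathfrak W(U)$ is a right-angled triangle or a diameter of the unit circle; * taupek iff $\omega\in\partial\mathfrak W(U)\setminus(\sigma(U)\cup\{0\})$; * finite-elliptic iff $\omega\in\operatorname{Int}\mathfrak W(U)\setminus\{0\}$, $\dfrac{(\operatorname{tr}U-\omega)^2}{\overline\omega\det U}\in[0,4)$ and $\arccos\dfrac{|\operatorname{tr}U-\omega|}{2\sqrt{|\omega|}}\in\pi\mathbb{Q}$; such a chain is circular iff $\omega=\operatorname{tr}U$; * $\infty$-elliptic iff $\omega\in\operatorname{Int}\mathfrak W(U)\setminus\{0\}$, $\dfrac{(\operatorname{tr}U-\omega)^2}{\overline\omega\det U}\in(0,4)$ and $\arccos\dfrac{|\operatorname{tr}U-\omega|}{2\sqrt{|\omega|}}\notin\pi\mathbb{Q}$; * generic in all other cases, that is, iff none of the conditions on $\omega$ listed above for the unitary, null, taupek, finite-elliptic and $\infty$-elliptic types holds. -/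

import Mathlib

open scoped ComplexConjugate ComplexOrder

noncomputable section

namespace BallPoint

/-- The Hilbert space `ℂ^d`. -/
abbrev Hilb (d : ℕ) : Type := EuclideanSpace ℂ (Fin d)

/-- Quantum states on `ℂ^d`: positive semi-definite linear maps of trace one. -/
def State (d : ℕ) : Type :=
  {ρ : Hilb d →ₗ[ℂ] Hilb d // ρ.IsPositive ∧ LinearMap.trace ℂ (Hilb d) ρ = 1}

/-- A partial iterated function system on `X` with `k` branches: place-dependent probabilities
which sum to one, and evolution maps, the `i`-th being defined exactly where the `i`-th
probability is positive. It drives the Markov chain on `X` which moves from `x` to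
`evol i x` with probability `prob i x`. -/
structure PIFS (X : Type) (k : ℕ) where
  prob : Fin k → X → ℝ
  prob_nonneg : ∀ i x, 0 ≤ prob i x
  prob_sum : ∀ x, ∑ i, prob i x = 1
  evol : ∀ (i : Fin k) (x : X), 0 < prob i x → X

/-- Projection valued measures on `ℂ^d` with `k` outcomes. -/
structure PVM (d k : ℕ) where
  proj : Fin k → (Hilb d →ₗ[ℂ] Hilb d)
  isProj : ∀ i, IsStarProjection (proj i)
  ne_zero : ∀ i, proj i ≠ 0
  sum_eq : ∑ i, proj i = 1

/-- The unnormalised state `Π U ρ U* Π` after the evolution `U` and the outcome with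
projection `Π`. -/
def branch {d : ℕ} (U P ρ : Hilb d →ₗ[ℂ] Hilb d) : Hilb d →ₗ[ℂ] Hilb d :=
  P * (U * ρ * star U) * P

theorem branch_isPositive {d : ℕ} (U P ρ : Hilb d →ₗ[ℂ] Hilb d) (hP : IsStarProjection P)
    (hρ : ρ.IsPositive) : (branch U P ρ).IsPositive := by
  have h := (hρ.conj_adjoint U).conj_adjoint P
  have hPs : LinearMap.adjoint P = P := hP.isSelfAdjoint
  rw [hPs] at h
  exact h

theorem trace_branch {d : ℕ} (U P ρ : Hilb d →ₗ[ℂ] Hilb d) (hP : IsStarProjection P) :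
    LinearMap.trace ℂ (Hilb d) (branch U P ρ) =
      LinearMap.trace ℂ (Hilb d) (P * (U * ρ * star U)) := by
  rw [branch, LinearMap.trace_mul_comm, ← mul_assoc, hP.isIdempotentElem.eq]

theorem trace_branch_nonneg {d : ℕ} (U P ρ : Hilb d →ₗ[ℂ] Hilb d) (hP : IsStarProjection P)
    (hρ : ρ.IsPositive) : 0 ≤ LinearMap.trace ℂ (Hilb d) (P * (U * ρ * star U)) := by
  rw [← trace_branch U P ρ hP]
  exact (branch_isPositive U P ρ hP hρ).trace_nonneg

/-- The PIFS generated by a unitary `U` and a projective measurement `Π`: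
`p_i(ρ) = tr(Π_i U ρ U*)` and `F_i(ρ) = Π_i U ρ U* Π_i / tr(Π_i U ρ U*)`. -/
def pifs {d k : ℕ} (U : unitary (Hilb d →ₗ[ℂ] Hilb d)) (P : PVM d k) : PIFS (State d) k where
  prob i ρ := (LinearMap.trace ℂ (Hilb d) (P.proj i * (U.1 * ρ.1 * star U.1))).re
  prob_nonneg i ρ :=
    (Complex.le_def.1 (trace_branch_nonneg U.1 (P.proj i) ρ.1 (P.isProj i) ρ.2.1)).1
  prob_sum ρ := by
    have h : (∑ i, LinearMap.trace ℂ (Hilb d) (P.proj i * (U.1 * ρ.1 * star U.1))) = 1 := by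
      rw [← map_sum, ← Finset.sum_mul, P.sum_eq, one_mul, LinearMap.trace_mul_comm, ← mul_assoc,
        Unitary.star_mul_self_of_mem U.2, one_mul, ρ.2.2]
    rw [← Complex.re_sum, h, Complex.one_re]
  evol i ρ hpos :=
    ⟨(((LinearMap.trace ℂ (Hilb d) (P.proj i * (U.1 * ρ.1 * star U.1))).re⁻¹ : ℝ) : ℂ) •
        branch U.1 (P.proj i) ρ.1, by
      have hn := trace_branch_nonneg U.1 (P.proj i) ρ.1 (P.isProj i) ρ.2.1
      refine ⟨(branch_isPositive U.1 (P.proj i) ρ.1 (P.isProj i) ρ.2.1).smul_of_nonneg ?_, ?_⟩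
      · exact Complex.zero_le_real.2 (inv_nonneg.2 hpos.le)
      · rw [map_smul, trace_branch U.1 (P.proj i) ρ.1 (P.isProj i), smul_eq_mul]
        have him := (Complex.le_def.1 hn).2
        generalize LinearMap.trace ℂ (Hilb d) (P.proj i * (U.1 * ρ.1 * star U.1)) = t at hpos him
        have ht : t = ((t.re : ℝ) : ℂ) := Complex.ext rfl (by simpa using him.symm)
        rw [ht, Complex.ofReal_re, ← Complex.ofReal_mul, inv_mul_cancel₀ hpos.ne',
          Complex.ofReal_one]⟩

/-- The orthogonal projection `ρ_z` onto the line spanned by a unit vector `z`. -/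
def pureState {d : ℕ} (z : Hilb d) : Hilb d →ₗ[ℂ] Hilb d :=
  (InnerProductSpace.rankOne ℂ z z : Hilb d →L[ℂ] Hilb d)

theorem pureState_isStarProjection {d : ℕ} (z : Hilb d) (hz : ‖z‖ = 1) :
    IsStarProjection (pureState z) := by
  rw [LinearMap.isStarProjection_iff_isSymmetricProjection]
  exact InnerProductSpace.isSymmetricProjection_rankOne_self hz

theorem trace_pureState {d : ℕ} (z : Hilb d) (hz : ‖z‖ = 1) :
    LinearMap.trace ℂ (Hilb d) (pureState z) = 1 := by
  rw [pureState, InnerProductSpace.trace_rankOne]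
  simp [inner_self_eq_norm_sq_to_K, hz]

/-- The measurement `Π(z)` of a qutrit: the rank-two projection `1 - ρ_z` is the first outcome
(index `0`) and the rank-one projection `ρ_z` the second one (index `1`). -/
def ballPointPVM (z : Hilb 3) (hz : ‖z‖ = 1) : PVM 3 2 where
  proj := ![1 - pureState z, pureState z]
  isProj := by
    have h := pureState_isStarProjection z hz
    intro i
    fin_cases i
    · exact h.one_sub
    · exact h
  ne_zero := by
    have h := trace_pureState z hz
    intro i
    fin_cases i
    · intro h0
      have h1 : (1 : Hilb 3 →ₗ[ℂ] Hilb 3) = pureState z := sub_eq_zero.1 h0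
      rw [← h1, LinearMap.trace_one] at h
      simp at h
    · intro h0
      have h1 : pureState z = 0 := h0
      rw [h1, map_zero] at h
      exact zero_ne_one h
  sum_eq := by simp

/-- The operator `A = Π₁ U` restricted to (and regarded as an operator on) the plane
`Θ = span{z}ᗮ`. -/
def ballOperator (U : Hilb 3 →ₗ[ℂ] Hilb 3) (z : Hilb 3) :
    ((ℂ ∙ z)ᗮ : Submodule ℂ (Hilb 3)) →ₗ[ℂ] ((ℂ ∙ z)ᗮ : Submodule ℂ (Hilb 3)) :=
  ((ℂ ∙ z)ᗮ.orthogonalProjectionOnto : Hilb 3 →ₗ[ℂ] ((ℂ ∙ z)ᗮ : Submodule ℂ (Hilb 3))) ∘ₗ U ∘ₗ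
    (ℂ ∙ z)ᗮ.subtype

/-- The types of chains of the ball & point system. `null` comprises the three types
`genericNull`, `doubleNull`, `taupekNull`, and `circular` is a special case of
`finiteElliptic`. -/
inductive ChainType
  | unitary
  | null
  | genericNull
  | doubleNull
  | taupekNull
  | taupek
  | finiteElliptic
  | circular
  | inftyElliptic
  | generic

/-- `x` is a rational multiple of `π`. -/
def IsPiRat (x : ℝ) : Prop := ∃ q : ℚ, x = Real.pi * q

/-- The case distinction which defines the types, in terms of the eigenvalues `l₁`, `l₂` of the
operator `A`, ordered so that `|l₂| ≤ |l₁|`. The phase is `ψ = Arg (l₂ / l₁)`. -/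
def ChainType.Case : ChainType → ℂ → ℂ → Prop
  | .unitary, l₁, l₂ => ‖l₂‖ = 1 ∧ ‖l₁‖ = 1
  | .null, _, l₂ => l₂ = 0
  | .genericNull, l₁, l₂ => l₂ = 0 ∧ 0 < ‖l₁‖ ∧ ‖l₁‖ < 1
  | .doubleNull, l₁, l₂ => l₂ = 0 ∧ l₁ = 0
  | .taupekNull, l₁, l₂ => l₂ = 0 ∧ ‖l₁‖ = 1
  | .taupek, l₁, l₂ => 0 < ‖l₂‖ ∧ ‖l₂‖ < ‖l₁‖ ∧ ‖l₁‖ = 1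
  | .finiteElliptic, l₁, l₂ => 0 < ‖l₂‖ ∧ ‖l₂‖ = ‖l₁‖ ∧ ‖l₁‖ < 1 ∧
      IsPiRat (Complex.arg (l₂ / l₁)) ∧ Complex.arg (l₂ / l₁) ≠ 0
  | .circular, l₁, l₂ => 0 < ‖l₂‖ ∧ ‖l₂‖ = ‖l₁‖ ∧ ‖l₁‖ < 1 ∧
      Complex.arg (l₂ / l₁) = Real.pi
  | .inftyElliptic, l₁, l₂ => 0 < ‖l₂‖ ∧ ‖l₂‖ = ‖l₁‖ ∧ ‖l₁‖ < 1 ∧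
      ¬ IsPiRat (Complex.arg (l₂ / l₁))
  | .generic, l₁, l₂ => (0 < ‖l₂‖ ∧ ‖l₂‖ < ‖l₁‖ ∧ ‖l₁‖ < 1) ∨
      (l₁ = l₂ ∧ 0 < ‖l₁‖ ∧ ‖l₁‖ < 1)

/-- The Markov chain generated by the PIFS `F` of a ball & point system is of type `t`: `F` is
the PIFS of some unitary `U` and measurement `Π(z)` for which the eigenvalues (with multiplicity)
of `A` are in the case `t`. On the plane `Θ` the first evolution map is
`ρ ↦ A ρ A* / tr (A ρ A*)`, so that `F` determines `z` and `A` up to phases, on which the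
cases do not depend. -/
def PIFS.GeneratesChain (F : PIFS (State 3) 2) (t : ChainType) : Prop :=
  ∃ (U : unitary (Hilb 3 →ₗ[ℂ] Hilb 3)) (z : Hilb 3) (hz : ‖z‖ = 1),
    F = pifs U (ballPointPVM z hz) ∧
    ∃ l₁ l₂ : ℂ, (ballOperator U.1 z).charpoly.roots = {l₁, l₂} ∧ ‖l₂‖ ≤ ‖l₁‖ ∧ t.Case l₁ l₂

/-- The numerical range. -/
def numRange {d : ℕ} (T : Hilb d →ₗ[ℂ] Hilb d) : Set ℂ :=
  {w | ∃ z : Hilb d, ‖z‖ = 1 ∧ inner ℂ z (T z) = w}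

/-- The set of eigenvalues. -/
def eigenvalueSet {d : ℕ} (T : Hilb d →ₗ[ℂ] Hilb d) : Set ℂ :=
  {μ | Module.End.HasEigenvalue T μ}

/-- `S` is the solid triangle, automatically non-degenerate, with vertices `t.points`. -/
def IsTriangle (S : Set ℂ) (t : Affine.Triangle ℝ ℂ) : Prop :=
  S = convexHull ℝ (Set.range t.points)

/-- `S` is an acute triangle which is not equilateral. -/
def IsAcuteNonEquilateral (S : Set ℂ) : Prop :=
  ∃ t : Affine.Triangle ℝ ℂ, IsTriangle S t ∧ t.AcuteAngled ∧ ¬ t.Equilateral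

/-- `S` is an equilateral triangle. -/
def IsEquilateral (S : Set ℂ) : Prop :=
  ∃ t : Affine.Triangle ℝ ℂ, IsTriangle S t ∧ t.Equilateral

/-- `S` is a right-angled triangle. -/
def IsRightAngled (S : Set ℂ) : Prop :=
  ∃ t : Affine.Triangle ℝ ℂ, IsTriangle S t ∧ ∃ i j k : Fin 3, i ≠ j ∧ j ≠ k ∧ k ≠ i ∧
    EuclideanGeometry.angle (t.points i) (t.points j) (t.points k) = Real.pi / 2

/-- `S` is a diameter of the unit circle. -/
def IsDiameter (S : Set ℂ) : Prop :=
  ∃ a : ℂ, ‖a‖ = 1 ∧ S = segment ℝ (-a) a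

/-- The quantity `(tr U - ω)² / (ω̄ det U)`. -/
def ellRatio (U : Hilb 3 →ₗ[ℂ] Hilb 3) (ω : ℂ) : ℂ :=
  (LinearMap.trace ℂ (Hilb 3) U - ω) ^ 2 / (conj ω * LinearMap.det U)

/-- The angle `arccos (|tr U - ω| / (2 √|ω|))`. -/
def ellAngle (U : Hilb 3 →ₗ[ℂ] Hilb 3) (ω : ℂ) : ℝ :=
  Real.arccos (‖LinearMap.trace ℂ (Hilb 3) U - ω‖ / (2 * √‖ω‖))

/-- `∂W(U) \ (σ(U) ∪ {0})`, with the boundary taken in the plane. -/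
def taupekRegion (U : Hilb 3 →ₗ[ℂ] Hilb 3) : Set ℂ :=
  frontier (numRange U) \ (eigenvalueSet U ∪ {0})

/-- Non-zero interior points of `W(U)` with ratio in `[0, 4)` and angle in `πℚ`. -/
def finiteEllipticRegion (U : Hilb 3 →ₗ[ℂ] Hilb 3) : Set ℂ :=
  {ω | ω ∈ interior (numRange U) \ {0} ∧
    (∃ r : ℝ, 0 ≤ r ∧ r < 4 ∧ ellRatio U ω = r) ∧ IsPiRat (ellAngle U ω)}

/-- Non-zero interior points of `W(U)` with ratio in `(0, 4)` and angle outside `πℚ`. -/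
def inftyEllipticRegion (U : Hilb 3 →ₗ[ℂ] Hilb 3) : Set ℂ :=
  {ω | ω ∈ interior (numRange U) \ {0} ∧
    (∃ r : ℝ, 0 < r ∧ r < 4 ∧ ellRatio U ω = r) ∧ ¬ IsPiRat (ellAngle U ω)}

end BallPoint

end

namespace BallPoint

/-! In an orthonormal eigenbasis `b` of `U`, with eigenvalues `μ k` on the unit circle, put pₖ =
|⟨bₖ, z⟩|². Then ω = ∑ pₖ μₖ, and W(U) is the convex hull of the `μ k`. Traces of A and A² give l₁ +
l₂ = tr U - ω and l₁ l₂ = ω̄ det U. Equivalently, (x - l₁)(x - l₂) = ∑ₖ pₖ ∏_{j≠k} (x - μⱼ), so that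
away from the μₖ the eigenvalues of A are the zeros of ∑ pₖ / (x - μₖ).

Everything is read off from this (`SpectralData`). Since Re (x / (x - μₖ)) ≥ 1/2 for |x| ≥ 1, no
zero lies on or outside the circle except at some μₖ. Hence |l₁| ≤ 1, with equality iff some pₖ
vanishes or two μₖ coincide, that is, iff ω ∈ ∂W(U) (`norm_eq_one_iff`, `mem_frontier_iff`).
Moreover |l₁| |l₂| = |ω|, which settles the unitary case (|ω| = 1, i.e. ω is an eigenvalue, by
Cauchy–Schwarz) and the null case (ω = 0).

If ω = 0, then l₁ = ∑ μₖ, and the triangle with vertices μₖ has its circumcentre in its hull. The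
sum vanishes iff the triangle is equilateral; it has modulus one iff two μₖ are antipodal, which by
Thales means a right angle or a diameter.

For the elliptic types, (l₁ + l₂)² / (l₁ l₂) = 2 + q + q⁻¹ with q = l₂ / l₁, which lies in [0, 4)
iff |q| = 1 and q ≠ 1, and then the arccosine is |ψ| / 2 (`exists_ratio_iff`, `arccos_ratio_eq`).

As `GeneratesChain` quantifies over all (U, z) realising the system, it is also needed that the
system determines Π₁U up to a phase (`ballMap_eq_smul_of_pifs_eq`). -/

/-! ### Unitary operators: spectral decomposition and numerical range. -/

theorem inner_map_map_of_mem_unitary {d : ℕ} {U : Hilb d →ₗ[ℂ] Hilb d} (hU : U ∈ unitary _)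
    (x y : Hilb d) : inner ℂ (U x) (U y) = inner ℂ x y := by
  have h : LinearMap.adjoint U * U = 1 := Unitary.star_mul_self_of_mem hU
  rw [← LinearMap.adjoint_inner_right, ← Module.End.mul_apply, h, Module.End.one_apply]

theorem norm_map_of_mem_unitary {d : ℕ} {U : Hilb d →ₗ[ℂ] Hilb d} (hU : U ∈ unitary _)
    (x : Hilb d) : ‖U x‖ = ‖x‖ := by
  rw [norm_eq_sqrt_re_inner (𝕜 := ℂ), norm_eq_sqrt_re_inner (𝕜 := ℂ) x,
    inner_map_map_of_mem_unitary hU]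

theorem norm_eq_one_of_mem_unitary {d : ℕ} {U : Hilb d →ₗ[ℂ] Hilb d} (hU : U ∈ unitary _)
    {x : Hilb d} (hx : x ≠ 0) {c : ℂ} (h : U x = c • x) : ‖c‖ = 1 := by
  have h1 := norm_map_of_mem_unitary hU x
  rw [h, norm_smul] at h1
  exact mul_right_cancel₀ (norm_ne_zero_iff.2 hx) (by rw [h1, one_mul])

/-- Spectral theorem for unitary operators. -/
theorem exists_orthonormalBasis_of_mem_unitary {d : ℕ} {U : Hilb d →ₗ[ℂ] Hilb d}
    (hU : U ∈ unitary _) :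
    ∃ (b : OrthonormalBasis (Fin d) ℂ (Hilb d)) (μ : Fin d → ℂ),
      (∀ k, ‖μ k‖ = 1) ∧ ∀ k, U (b k) = μ k • b k := by
  have horth : OrthogonalFamily ℂ (fun c : Module.End.Eigenvalues U => Module.End.eigenspace U c)
      fun c => (Module.End.eigenspace U c).subtypeₗᵢ := by
    refine OrthogonalFamily.of_pairwise ?_
    rintro ⟨a, ha⟩ ⟨c, hc⟩ hac
    refine Submodule.isOrtho_iff_inner_eq.2 fun x hx y hy => ?_
    by_contra hne
    have hx' : U x = a • x := Module.End.mem_eigenspace_iff.1 hx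
    have hy' : U y = c • y := Module.End.mem_eigenspace_iff.1 hy
    have hx0 : x ≠ 0 := by rintro rfl; simp at hne
    have ha1 := norm_eq_one_of_mem_unitary hU hx0 hx'
    have h := inner_map_map_of_mem_unitary hU x y
    rw [hx', hy', inner_smul_left, inner_smul_right, ← mul_assoc] at h
    -- As |a| = 1, conj a is the inverse of a, so a preserved non-zero inner product forces a = c.
    have h2 : conj a * c = 1 := mul_right_cancel₀ hne (by rw [h, one_mul])
    have h3 : a * conj a = 1 := by rw [Complex.mul_conj, Complex.normSq_eq_norm_sq, ha1]; simp
    apply hac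
    apply Subtype.ext
    change a = c
    linear_combination (-a) * h2 + c * h3
  have htop : (⨆ c : Module.End.Eigenvalues U, Module.End.eigenspace U c)ᗮ = ⊥ := by
    set W := (⨆ c : Module.End.Eigenvalues U, Module.End.eigenspace U c)ᗮ with hW
    have hmem : ∀ v, v ∈ W ↔ ∀ (a : ℂ) (x : Hilb d), U x = a • x → inner ℂ x v = 0 := by
      intro v
      rw [hW, ← Submodule.iInf_orthogonal, Submodule.mem_iInf]
      constructor
      · intro h a x hx
        by_cases hx0 : x = 0
        · simp [hx0]
        have hev : Module.End.HasEigenvalue U a :=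
          Module.End.hasEigenvalue_of_hasEigenvector
            ⟨Module.End.mem_eigenspace_iff.2 hx, hx0⟩
        exact (Submodule.mem_orthogonal _ _).1 (h ⟨a, hev⟩) x (Module.End.mem_eigenspace_iff.2 hx)
      · intro h a
        exact (Submodule.mem_orthogonal _ _).2 fun x hx =>
          h a x (Module.End.mem_eigenspace_iff.1 hx)
    have hinv : ∀ v ∈ W, U v ∈ W := by
      intro v hv
      rw [hmem] at hv ⊢
      intro a x hx
      by_cases hx0 : x = 0
      · simp [hx0]
      have ha1 := norm_eq_one_of_mem_unitary hU hx0 hx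
      have ha0 : a ≠ 0 := by rintro rfl; simp at ha1
      have hxe : x = U (a⁻¹ • x) := by rw [map_smul, hx, smul_smul, inv_mul_cancel₀ ha0, one_smul]
      rw [hxe, inner_map_map_of_mem_unitary hU, inner_smul_left, hv a x hx, mul_zero]
    -- A non-zero invariant `W` would contain an eigenvector of `U`, which would be orthogonal to
    -- itself.
    by_contra hne
    have : Nontrivial W := Submodule.nontrivial_iff_ne_bot.2 hne
    obtain ⟨a, ha⟩ := Module.End.exists_eigenvalue (U.restrict hinv)
    obtain ⟨⟨v, hv⟩, hv1⟩ := ha.exists_hasEigenvector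
    have hva : U v = a • v := congrArg Subtype.val hv1.apply_eq_smul
    have h0 := (hmem v).1 hv a v hva
    apply hv1.2
    exact Subtype.ext (inner_self_eq_zero.1 h0)
  have hint := horth.isInternal_iff.2 htop
  have hd : Module.finrank ℂ (Hilb d) = d := by simp
  refine ⟨hint.subordinateOrthonormalBasis hd horth,
    fun k => (hint.subordinateOrthonormalBasisIndex hd k horth).1, ?_, ?_⟩
  · intro k
    exact norm_eq_one_of_mem_unitary hU
      ((hint.subordinateOrthonormalBasis hd horth).orthonormal.ne_zero k)
      (Module.End.mem_eigenspace_iff.1 (hint.subordinateOrthonormalBasis_subordinate hd k horth))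
  · intro k
    exact Module.End.mem_eigenspace_iff.1 (hint.subordinateOrthonormalBasis_subordinate hd k horth)

section Diagonal

variable {d : ℕ} {U : Hilb d →ₗ[ℂ] Hilb d} {b : OrthonormalBasis (Fin d) ℂ (Hilb d)}
  {μ : Fin d → ℂ}

theorem toMatrix_eq_diagonal (hb : ∀ k, U (b k) = μ k • b k) :
    LinearMap.toMatrix b.toBasis b.toBasis U = Matrix.diagonal μ := by
  ext i j
  rw [LinearMap.toMatrix_apply, OrthonormalBasis.coe_toBasis, hb, map_smul,
    ← OrthonormalBasis.coe_toBasis, Module.Basis.repr_self]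
  by_cases h : i = j
  · subst h; simp
  · simp [h]

theorem trace_eq_sum_of_diagonal (hb : ∀ k, U (b k) = μ k • b k) :
    LinearMap.trace ℂ (Hilb d) U = ∑ k, μ k := by
  rw [LinearMap.trace_eq_matrix_trace ℂ b.toBasis, toMatrix_eq_diagonal hb, Matrix.trace_diagonal]

theorem det_eq_prod_of_diagonal (hb : ∀ k, U (b k) = μ k • b k) :
    LinearMap.det U = ∏ k, μ k := by
  rw [← LinearMap.det_toMatrix b.toBasis, toMatrix_eq_diagonal hb, Matrix.det_diagonal]

theorem inner_map_self_of_diagonal (hb : ∀ k, U (b k) = μ k • b k) (x : Hilb d) :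
    inner ℂ x (U x) = ∑ k, ((‖inner ℂ (b k) x‖ ^ 2 : ℝ) : ℂ) * μ k := by
  have hx : U x = ∑ k, (inner ℂ (b k) x * μ k) • b k := by
    conv_lhs => rw [← b.sum_repr' x]
    simp only [map_sum, map_smul, hb, smul_smul]
  rw [hx, inner_sum]
  refine Finset.sum_congr rfl fun k _ => ?_
  rw [inner_smul_right, ← inner_conj_symm x (b k), mul_right_comm, Complex.mul_conj,
    Complex.normSq_eq_norm_sq]

theorem numRange_eq_convexHull (hb : ∀ k, U (b k) = μ k • b k) :
    numRange U = convexHull ℝ (Set.range μ) := by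
  ext w
  rw [convexHull_range_eq_exists_affineCombination]
  constructor
  · rintro ⟨x, hx, rfl⟩
    have hsum : ∑ k, ‖inner ℂ (b k) x‖ ^ 2 = 1 := by
      rw [b.sum_sq_norm_inner_right, hx, one_pow]
    refine ⟨Finset.univ, fun k => ‖inner ℂ (b k) x‖ ^ 2, fun _ _ => by positivity, hsum, ?_⟩
    rw [Finset.affineCombination_eq_linear_combination _ _ _ hsum, inner_map_self_of_diagonal hb]
    simp
  · rintro ⟨s, p, hp, hs, rfl⟩
    -- The weights `p` are constrained only on `s`; extended by zero they become the squared
    -- coordinates of the unit vector `x`.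
    let q : Fin d → ℝ := fun k => if k ∈ s then p k else 0
    have hq0 : ∀ k, 0 ≤ q k := by
      intro k
      by_cases h : k ∈ s
      · simpa [q, h] using hp k h
      · simp [q, h]
    let x : Hilb d := ∑ k, ((√(q k) : ℝ) : ℂ) • b k
    have hx : ∀ k, inner ℂ (b k) x = ((√(q k) : ℝ) : ℂ) := by
      intro k
      exact b.orthonormal.inner_right_fintype _ k
    have hn : ∀ k, ‖inner ℂ (b k) x‖ ^ 2 = q k := by
      intro k
      rw [hx, Complex.norm_real, Real.norm_eq_abs, sq_abs, Real.sq_sqrt (hq0 k)]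
    refine ⟨x, ?_, ?_⟩
    · have h1 := b.sum_sq_norm_inner_right x
      simp only [hn] at h1
      have h2 : ∑ k, q k = 1 := by simpa [q] using hs
      rw [h2] at h1
      exact (sq_eq_sq₀ (norm_nonneg _) zero_le_one).1 (by rw [← h1, one_pow])
    · rw [inner_map_self_of_diagonal hb, Finset.affineCombination_eq_linear_combination _ _ _ hs]
      simp only [hn]
      simp [q, apply_ite, ite_mul]

end Diagonal


/-! ### The eigenvalues of A through traces. -/

theorem pair_eq_pair_of_add_eq_of_mul_eq {a b c d : ℂ} (hs : a + b = c + d) (hp : a * b = c * d) :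
    ({a, b} : Multiset ℂ) = {c, d} := by
  have h : (a - c) * (a - d) = 0 := by linear_combination a * hs - hp
  rcases mul_eq_zero.1 h with h | h
  · have h1 : a = c := sub_eq_zero.1 h
    have h2 : b = d := by linear_combination hs - h1
    rw [h1, h2]
  · have h1 : a = d := sub_eq_zero.1 h
    have h2 : b = c := by linear_combination hs - h1
    rw [h1, h2, Multiset.pair_comm]

section TwoDim

variable {V : Type*} [AddCommGroup V] [Module ℂ V] [Module.Finite ℂ V]

theorem exists_roots_charpoly_eq_pair (hV : Module.finrank ℂ V = 2) (f : V →ₗ[ℂ] V) :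
    ∃ a b : ℂ, f.charpoly.roots = {a, b} := by
  have h := (IsAlgClosed.splits f.charpoly).natDegree_eq_card_roots
  rw [LinearMap.charpoly_natDegree, hV] at h
  exact Multiset.card_eq_two.1 h.symm

theorem trace_sq_eq_of_finrank_eq_two (hV : Module.finrank ℂ V = 2) (f : V →ₗ[ℂ] V) :
    LinearMap.trace ℂ V (f * f) = LinearMap.trace ℂ V f ^ 2 - 2 * LinearMap.det f := by
  let b : Module.Basis (Fin 2) ℂ V := Module.finBasisOfFinrankEq ℂ V hV
  rw [LinearMap.trace_eq_matrix_trace ℂ b, LinearMap.trace_eq_matrix_trace ℂ b,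
    ← LinearMap.det_toMatrix b, LinearMap.toMatrix_mul, Matrix.det_fin_two, Matrix.trace_fin_two,
    Matrix.trace_fin_two, Matrix.mul_apply, Matrix.mul_apply, Fin.sum_univ_two, Fin.sum_univ_two]
  ring

/-- Power sums replace the determinant because the trace of an operator with range in a subspace
equals that of its restriction. A on Θ can thus be exchanged for Π₁U on the whole space, whose
determinant carries no information. -/
theorem roots_charpoly_eq_pair_iff (hV : Module.finrank ℂ V = 2) (f : V →ₗ[ℂ] V) (a b : ℂ) :
    f.charpoly.roots = {a, b} ↔
      a + b = LinearMap.trace ℂ V f ∧ a ^ 2 + b ^ 2 = LinearMap.trace ℂ V (f * f) := by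
  have key : ∀ c d : ℂ, f.charpoly.roots = {c, d} →
      c + d = LinearMap.trace ℂ V f ∧ c ^ 2 + d ^ 2 = LinearMap.trace ℂ V (f * f) := by
    intro c d h
    have h1 := Module.End.trace_eq_sum_roots_charpoly_of_splits (IsAlgClosed.splits f.charpoly)
    have h2 := Module.End.det_eq_prod_roots_charpoly_of_splits (IsAlgClosed.splits f.charpoly)
    rw [h] at h1 h2
    simp only [Multiset.insert_eq_cons, Multiset.sum_cons, Multiset.sum_singleton,
      Multiset.prod_cons, Multiset.prod_singleton] at h1 h2
    refine ⟨h1.symm, ?_⟩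
    rw [trace_sq_eq_of_finrank_eq_two hV, h1, h2]
    ring
  refine ⟨key a b, fun ⟨h1, h2⟩ => ?_⟩
  obtain ⟨c, d, hcd⟩ := exists_roots_charpoly_eq_pair hV f
  obtain ⟨h3, h4⟩ := key c d hcd
  rw [hcd]
  refine pair_eq_pair_of_add_eq_of_mul_eq (h3.trans h1.symm) ?_
  have h5 : (c + d) ^ 2 = (a + b) ^ 2 := by rw [h3, h1]
  linear_combination (1 / 2 : ℂ) * h5 - (1 / 2 : ℂ) * (h4.trans h2.symm)

end TwoDim

/-- The operator `Π₁ U` on the whole space. -/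
noncomputable def ballMap {d : ℕ} (U : Hilb d →ₗ[ℂ] Hilb d) (z : Hilb d) : Hilb d →ₗ[ℂ] Hilb d :=
  (1 - pureState z) * U

theorem pureState_apply {d : ℕ} (z x : Hilb d) : pureState z x = inner ℂ z x • z := by
  simp [pureState, InnerProductSpace.rankOne_apply]

theorem trace_pureState_mul {d : ℕ} (z : Hilb d) (T : Hilb d →ₗ[ℂ] Hilb d) :
    LinearMap.trace ℂ (Hilb d) (pureState z * T) = inner ℂ z (T z) := by
  have h : T * pureState z =
      ((InnerProductSpace.rankOne ℂ (T z) z : Hilb d →L[ℂ] Hilb d) : Hilb d →ₗ[ℂ] Hilb d) := by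
    ext1 x
    simp [pureState_apply, InnerProductSpace.rankOne_apply]
  rw [LinearMap.trace_mul_comm, h, InnerProductSpace.trace_rankOne]

theorem coe_ballOperator_apply {U : Hilb 3 →ₗ[ℂ] Hilb 3} {z : Hilb 3} (hz : ‖z‖ = 1)
    (x : ((ℂ ∙ z)ᗮ : Submodule ℂ (Hilb 3))) :
    (ballOperator U z x : Hilb 3) = ballMap U z x := by
  change (((ℂ ∙ z)ᗮ.orthogonalProjectionOnto (U x) : ((ℂ ∙ z)ᗮ : Submodule ℂ (Hilb 3))) :
    Hilb 3) = _
  rw [Submodule.coe_orthogonalProjectionOnto_apply, Submodule.starProjection_orthogonal']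
  simp [ballMap, pureState_apply, Submodule.starProjection_unit_singleton ℂ hz]

theorem ballMap_mem {U : Hilb 3 →ₗ[ℂ] Hilb 3} {z : Hilb 3} (hz : ‖z‖ = 1) (x : Hilb 3) :
    ballMap U z x ∈ ((ℂ ∙ z)ᗮ : Submodule ℂ (Hilb 3)) := by
  rw [Submodule.mem_orthogonal_singleton_iff_inner_right]
  simp [ballMap, pureState_apply, inner_sub_right, inner_smul_right, inner_self_eq_norm_sq_to_K, hz]

theorem trace_ballOperator {U : Hilb 3 →ₗ[ℂ] Hilb 3} {z : Hilb 3} (hz : ‖z‖ = 1) :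
    LinearMap.trace ℂ _ (ballOperator U z) = LinearMap.trace ℂ (Hilb 3) (ballMap U z) := by
  rw [← LinearMap.trace_restrict_eq_of_forall_mem _ _ (ballMap_mem (U := U) hz)]
  congr 1
  ext1 x
  exact Subtype.ext (coe_ballOperator_apply hz x)

theorem trace_ballOperator_sq {U : Hilb 3 →ₗ[ℂ] Hilb 3} {z : Hilb 3} (hz : ‖z‖ = 1) :
    LinearMap.trace ℂ _ (ballOperator U z * ballOperator U z) =
      LinearMap.trace ℂ (Hilb 3) (ballMap U z * ballMap U z) := by
  rw [← LinearMap.trace_restrict_eq_of_forall_mem ((ℂ ∙ z)ᗮ) (ballMap U z * ballMap U z)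
    (fun x => ballMap_mem hz _)]
  congr 1
  ext1 x
  apply Subtype.ext
  change (ballOperator U z (ballOperator U z x) : Hilb 3) = ballMap U z (ballMap U z x)
  rw [coe_ballOperator_apply hz, coe_ballOperator_apply hz]

theorem finrank_orthogonal_eq_two {z : Hilb 3} (hz : ‖z‖ = 1) :
    Module.finrank ℂ ((ℂ ∙ z)ᗮ : Submodule ℂ (Hilb 3)) = 2 := by
  have : Fact (Module.finrank ℂ (Hilb 3) = 2 + 1) := ⟨by simp⟩
  exact Submodule.finrank_orthogonal_span_singleton (by rintro rfl; simp at hz)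

theorem roots_ballOperator_iff {U : Hilb 3 →ₗ[ℂ] Hilb 3} {z : Hilb 3} (hz : ‖z‖ = 1) (a b : ℂ) :
    (ballOperator U z).charpoly.roots = {a, b} ↔
      a + b = LinearMap.trace ℂ (Hilb 3) (ballMap U z) ∧
      a ^ 2 + b ^ 2 = LinearMap.trace ℂ (Hilb 3) (ballMap U z * ballMap U z) := by
  rw [roots_charpoly_eq_pair_iff (finrank_orthogonal_eq_two hz), trace_ballOperator hz,
    trace_ballOperator_sq hz]

theorem trace_ballMap {d : ℕ} (U : Hilb d →ₗ[ℂ] Hilb d) (z : Hilb d) :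
    LinearMap.trace ℂ (Hilb d) (ballMap U z) =
      LinearMap.trace ℂ (Hilb d) U - inner ℂ z (U z) := by
  rw [ballMap, sub_mul, one_mul, map_sub, trace_pureState_mul]

theorem trace_ballMap_sq {d : ℕ} (U : Hilb d →ₗ[ℂ] Hilb d) (z : Hilb d) :
    LinearMap.trace ℂ (Hilb d) (ballMap U z * ballMap U z) =
      LinearMap.trace ℂ (Hilb d) (U * U) - 2 * inner ℂ z (U (U z)) + inner ℂ z (U z) ^ 2 := by
  have h : ballMap U z * ballMap U z = U * U - pureState z * (U * U) - U * pureState z * U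
      + pureState z * (U * pureState z * U) := by
    rw [ballMap]; noncomm_ring
  rw [h, map_add, map_sub, map_sub, trace_pureState_mul, trace_pureState_mul,
    LinearMap.trace_mul_comm ℂ (U * pureState z) U, ← mul_assoc,
    LinearMap.trace_mul_comm ℂ (U * U) (pureState z), trace_pureState_mul]
  simp only [Module.End.mul_apply, pureState_apply, map_smul, inner_smul_right]
  ring

/-- The elementary symmetric functions of the eigenvalues of `A` in spectral coordinates. -/
theorem eigenvalue_relations {U : Hilb 3 →ₗ[ℂ] Hilb 3} {b : OrthonormalBasis (Fin 3) ℂ (Hilb 3)}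
    {μ : Fin 3 → ℂ} (hμ : ∀ k, ‖μ k‖ = 1) (hb : ∀ k, U (b k) = μ k • b k) {z : Hilb 3}
    (hz : ‖z‖ = 1) {l₁ l₂ : ℂ}
    (h : (ballOperator U z).charpoly.roots = {l₁, l₂}) :
    l₁ + l₂ = LinearMap.trace ℂ (Hilb 3) U - inner ℂ z (U z) ∧
      l₁ * l₂ = conj (inner ℂ z (U z)) * LinearMap.det U := by
  obtain ⟨h1, h2⟩ := (roots_ballOperator_iff hz _ _).1 h
  rw [trace_ballMap] at h1
  refine ⟨h1, ?_⟩
  have hUU : ∀ k, (U * U) (b k) = (μ k ^ 2) • b k := by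
    intro k
    rw [Module.End.mul_apply, hb, map_smul, hb, smul_smul, sq]
  have hi2 : inner ℂ z (U (U z)) = _ := inner_map_self_of_diagonal hUU z
  have hs : ∑ k, ((‖inner ℂ (b k) z‖ ^ 2 : ℝ) : ℂ) = 1 := by
    rw [← Complex.ofReal_sum, b.sum_sq_norm_inner_right, hz]; simp
  have hm : ∀ k, μ k * conj (μ k) = 1 := by
    intro k
    rw [Complex.mul_conj, Complex.normSq_eq_norm_sq, hμ]; simp
  rw [trace_ballMap_sq, trace_eq_sum_of_diagonal hUU, hi2, inner_map_self_of_diagonal hb] at h2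
  rw [trace_eq_sum_of_diagonal hb, inner_map_self_of_diagonal hb] at h1
  rw [det_eq_prod_of_diagonal hb, inner_map_self_of_diagonal hb]
  generalize hp : (fun k => ((‖inner ℂ (b k) z‖ ^ 2 : ℝ) : ℂ)) = p
  have hp' : ∀ k, ((‖inner ℂ (b k) z‖ ^ 2 : ℝ) : ℂ) = p k := fun k => congrFun hp k
  have hpc : ∀ k, conj (p k) = p k := fun k => by rw [← hp', Complex.conj_ofReal]
  simp only [hp'] at h1 h2 hs ⊢
  simp only [Fin.sum_univ_three, Fin.prod_univ_three, map_add, map_mul, hpc] at h1 h2 hs ⊢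
  -- Newton's identity l₁ l₂ = ((l₁ + l₂)² - (l₁² + l₂²)) / 2; the relations `hm` turn ω̄ det U into
  -- ∑ pₖ ∏_{j≠k} μⱼ.
  have h3 := congrArg (· ^ 2) h1
  linear_combination (1 / 2 : ℂ) * h3 - (1 / 2 : ℂ) * h2 - p 0 * μ 1 * μ 2 * hm 0
    - p 1 * μ 0 * μ 2 * hm 1 - p 2 * μ 0 * μ 1 * hm 2
    - (μ 0 * μ 1 + μ 0 * μ 2 + μ 1 * μ 2) * hs


/-! ### The system determines Π₁U up to a phase. -/

open scoped Classical in
/-- The evolved state multiplied by its probability, `0` if the latter vanishes. -/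
noncomputable def PIFS.weighted {d k : ℕ} (F : PIFS (State d) k) (i : Fin k) (ρ : State d) :
    Hilb d →ₗ[ℂ] Hilb d :=
  if h : 0 < F.prob i ρ then (F.prob i ρ : ℂ) • (F.evol i ρ h).1 else 0

theorem _root_.LinearMap.IsPositive.eq_zero_of_trace_eq_zero {d : ℕ} {T : Hilb d →ₗ[ℂ] Hilb d}
    (hT : LinearMap.IsPositive T) (h : LinearMap.trace ℂ (Hilb d) T = 0) : T = 0 := by
  let b := stdOrthonormalBasis ℂ (Hilb d)
  rw [LinearMap.trace_eq_matrix_trace ℂ b.toBasis] at h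
  have hM := ((LinearMap.posSemidef_toMatrix_iff b).2 hT).trace_eq_zero_iff.1 h
  exact (LinearMap.toMatrix b.toBasis b.toBasis).map_eq_zero_iff.1 hM

/-- Undoing the normalisation turns the partial evolution into a total linear map: at zero
probability the branch is positive of trace zero, hence zero. -/
theorem weighted_pifs {d k : ℕ} (U : unitary (Hilb d →ₗ[ℂ] Hilb d)) (P : PVM d k) (i : Fin k)
    (ρ : State d) : (pifs U P).weighted i ρ = branch U.1 (P.proj i) ρ.1 := by
  have hpos := branch_isPositive U.1 (P.proj i) ρ.1 (P.isProj i) ρ.2.1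
  rw [PIFS.weighted]
  split_ifs with h
  · change ((pifs U P).prob i ρ : ℂ) • ((((pifs U P).prob i ρ)⁻¹ : ℝ) : ℂ) • _ = _
    rw [smul_smul, ← Complex.ofReal_mul, mul_inv_cancel₀ h.ne', Complex.ofReal_one, one_smul]
  · have h0 : (pifs U P).prob i ρ = 0 := le_antisymm (not_lt.1 h) ((pifs U P).prob_nonneg i ρ)
    have hn := trace_branch_nonneg U.1 (P.proj i) ρ.1 (P.isProj i) ρ.2.1
    have ht : LinearMap.trace ℂ (Hilb d) (branch U.1 (P.proj i) ρ.1) = 0 := by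
      rw [trace_branch U.1 (P.proj i) ρ.1 (P.isProj i)]
      exact Complex.ext h0 (Complex.le_def.1 hn).2.symm
    exact (hpos.eq_zero_of_trace_eq_zero ht).symm

/-- The state `ρ_x` of a unit vector. -/
noncomputable def stateOfUnit {d : ℕ} (x : Hilb d) (hx : ‖x‖ = 1) : State d :=
  ⟨pureState x, (InnerProductSpace.isSymmetricProjection_rankOne_self hx).isPositive,
    trace_pureState x hx⟩

theorem mul_pureState_mul_star {d : ℕ} (T : Hilb d →ₗ[ℂ] Hilb d) (x : Hilb d) :
    T * pureState x * star T = pureState (T x) := by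
  ext1 y
  have h : inner ℂ x (star T y) = inner ℂ (T x) y := LinearMap.adjoint_inner_right T x y
  simp [pureState_apply, h]

theorem pureState_smul {d : ℕ} (c : ℂ) (x : Hilb d) :
    pureState (c • x) = ((‖c‖ ^ 2 : ℝ) : ℂ) • pureState x := by
  ext1 y
  rw [LinearMap.smul_apply, pureState_apply, pureState_apply, inner_smul_left, smul_smul, smul_smul,
    ← Complex.normSq_eq_norm_sq, ← Complex.mul_conj]
  congr 1
  ring

theorem branch_pureState {d : ℕ} (U P : Hilb d →ₗ[ℂ] Hilb d) (hP : IsStarProjection P)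
    (x : Hilb d) : branch U P (pureState x) = pureState ((P * U) x) := by
  rw [← mul_pureState_mul_star, branch, star_mul, hP.isSelfAdjoint.star_eq]
  noncomm_ring

theorem exists_eq_smul_of_pureState_eq {d : ℕ} {S T : Hilb d →ₗ[ℂ] Hilb d}
    (h : ∀ x, pureState (S x) = pureState (T x)) : ∃ c : ℂ, ‖c‖ = 1 ∧ T = c • S := by
  have hn : ∀ x, ‖S x‖ = ‖T x‖ := by
    intro x
    have h1 := congrArg (LinearMap.trace ℂ (Hilb d)) (h x)
    simp only [pureState, InnerProductSpace.trace_rankOne, inner_self_eq_norm_sq_to_K] at h1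
    have h2 : ‖S x‖ ^ 2 = ‖T x‖ ^ 2 := by exact_mod_cast h1
    exact (sq_eq_sq₀ (norm_nonneg _) (norm_nonneg _)).1 h2
  by_cases hS : S = 0
  · refine ⟨1, norm_one, ?_⟩
    ext1 x
    have := hn x
    rw [hS, LinearMap.zero_apply, norm_zero] at this
    rw [hS, smul_zero, LinearMap.zero_apply]
    exact norm_eq_zero.1 this.symm
  obtain ⟨a, ha⟩ : ∃ a, S a ≠ 0 := by
    by_contra! hne
    exact hS (LinearMap.ext hne)
  have key : ∀ v w x : Hilb d, inner ℂ v (S x) • LinearMap.adjoint S w =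
      inner ℂ v (T x) • LinearMap.adjoint T w := by
    intro v w
    -- The quadratic form of `R Q` is x ↦ ⟨w, Qx⟩⟨Qx, v⟩, a matrix coefficient of `pureState (Q x)`.
    -- Over ℂ the quadratic form determines the operator.
    let R : (Hilb d →ₗ[ℂ] Hilb d) → (Hilb d →ₗ[ℂ] Hilb d) := fun Q =>
      ((InnerProductSpace.rankOne ℂ (LinearMap.adjoint Q w) (LinearMap.adjoint Q v) :
        Hilb d →L[ℂ] Hilb d) : Hilb d →ₗ[ℂ] Hilb d)
    have hR : ∀ Q x, R Q x = inner ℂ v (Q x) • LinearMap.adjoint Q w := by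
      intro Q x
      simp [R, InnerProductSpace.rankOne_apply, LinearMap.adjoint_inner_left]
    have hRR : R S = R T := by
      rw [← ext_inner_map]
      intro x
      rw [hR, hR, inner_smul_left, inner_smul_left, LinearMap.adjoint_inner_left,
        LinearMap.adjoint_inner_left, inner_conj_symm, inner_conj_symm]
      have h2 := congrArg conj (congrArg (fun Q : Hilb d →ₗ[ℂ] Hilb d => inner ℂ (Q v) w) (h x))
      simp only [pureState_apply, inner_smul_left, inner_conj_symm, map_mul] at h2
      linear_combination h2
    intro x
    rw [← hR, ← hR, hRR]
  have hS0 : ((‖S a‖ ^ 2 : ℝ) : ℂ) ≠ 0 := by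
    rw [Complex.ofReal_ne_zero]; exact pow_ne_zero 2 (norm_ne_zero_iff.2 ha)
  have hT0 : ((‖T a‖ ^ 2 : ℝ) : ℂ) ≠ 0 := by rwa [← hn a]
  have hc : ∃ c : ℂ, T = c • S := by
    -- With v = T a and x = a, `key` expresses the adjoint of `T` at w through that of `S`, with a
    -- factor independent of w.
    refine ⟨conj (((‖T a‖ ^ 2 : ℝ) : ℂ)⁻¹ * inner ℂ (T a) (S a)), ?_⟩
    apply LinearMap.adjoint.injective
    ext1 w
    have h1 := key (T a) w a
    rw [inner_self_eq_norm_sq_to_K] at h1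
    rw [map_smulₛₗ, LinearMap.smul_apply, starRingEnd_self_apply, mul_smul, h1, smul_smul]
    have : ((‖T a‖ ^ 2 : ℝ) : ℂ)⁻¹ * (((‖T a‖ : ℝ) : ℂ)) ^ 2 = 1 := by
      rw [← Complex.ofReal_pow, inv_mul_cancel₀ hT0]
    erw [this, one_smul]
  obtain ⟨c, rfl⟩ := hc
  refine ⟨c, ?_, rfl⟩
  have h1 := hn a
  rw [LinearMap.smul_apply, norm_smul] at h1
  exact mul_right_cancel₀ (norm_ne_zero_iff.2 ha) (by rw [← h1, one_mul])

/-- The PIFS determines `Π₁ U` up to a phase. -/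
theorem ballMap_eq_smul_of_pifs_eq {U U' : unitary (Hilb 3 →ₗ[ℂ] Hilb 3)} {z z' : Hilb 3}
    {hz : ‖z‖ = 1} {hz' : ‖z'‖ = 1}
    (h : pifs U (ballPointPVM z hz) = pifs U' (ballPointPVM z' hz')) :
    ∃ c : ℂ, ‖c‖ = 1 ∧ ballMap U'.1 z' = c • ballMap U.1 z := by
  have hbr : ∀ (x : Hilb 3), ‖x‖ = 1 →
      pureState (ballMap U.1 z x) = pureState (ballMap U'.1 z' x) := by
    intro x hx
    have h1 := congrArg (fun F => F.weighted 0 (stateOfUnit x hx)) h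
    simp only [weighted_pifs] at h1
    have h2 := branch_pureState U.1 _ ((ballPointPVM z hz).isProj 0) x
    have h3 := branch_pureState U'.1 _ ((ballPointPVM z' hz').isProj 0) x
    exact h2.symm.trans (h1.trans h3)
  refine exists_eq_smul_of_pureState_eq fun x => ?_
  by_cases hx : x = 0
  · simp [hx]
  -- Only unit vectors give states; both sides scale by ‖x‖², so the general case follows.
  have hx' : x = (‖x‖ : ℂ) • ((‖x‖⁻¹ : ℝ) : ℂ) • x := by
    rw [smul_smul, ← Complex.ofReal_mul, mul_inv_cancel₀ (norm_ne_zero_iff.2 hx),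
      Complex.ofReal_one, one_smul]
  have hu : ‖((‖x‖⁻¹ : ℝ) : ℂ) • x‖ = 1 := by
    rw [norm_smul, Complex.norm_real, norm_inv, norm_norm,
      inv_mul_cancel₀ (norm_ne_zero_iff.2 hx)]
  rw [hx', map_smul, map_smul (ballMap U'.1 z'), pureState_smul, pureState_smul, hbr _ hu]

/-- The cases involve only moduli, vanishing, equality and the quotient of the eigenvalues, so a
common phase is invisible to them. -/
theorem ChainType.Case.smul {t : ChainType} {l₁ l₂ c : ℂ} (hc : ‖c‖ = 1) (h : t.Case l₁ l₂) :
    t.Case (c * l₁) (c * l₂) := by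
  have hc0 : c ≠ 0 := by rintro rfl; simp at hc
  have hd : c * l₂ / (c * l₁) = l₂ / l₁ := mul_div_mul_left _ _ hc0
  cases t <;> simpa [ChainType.Case, hc, hd, hc0] using h

/-- The type of the chain can be read off from any unitary and measurement generating the PIFS. -/
theorem generatesChain_iff {U : unitary (Hilb 3 →ₗ[ℂ] Hilb 3)} {z : Hilb 3} (hz : ‖z‖ = 1)
    {F : PIFS (State 3) 2} (hF : F = pifs U (ballPointPVM z hz)) (t : ChainType) :
    F.GeneratesChain t ↔ ∃ l₁ l₂ : ℂ, (ballOperator U.1 z).charpoly.roots = {l₁, l₂} ∧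
      ‖l₂‖ ≤ ‖l₁‖ ∧ t.Case l₁ l₂ := by
  refine ⟨?_, fun h => ⟨U, z, hz, hF, h⟩⟩
  rintro ⟨U', z', hz', hF', l₁, l₂, hr, hle, ht⟩
  obtain ⟨c, hc, hcB⟩ := ballMap_eq_smul_of_pifs_eq (hF'.symm.trans hF)
  refine ⟨c * l₁, c * l₂, ?_, by simpa [hc] using hle, ht.smul hc⟩
  rw [roots_ballOperator_iff hz'] at hr
  rw [roots_ballOperator_iff hz, hcB]
  simp only [smul_mul_smul_comm, map_smul, smul_eq_mul, ← hr.1, ← hr.2]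
  constructor <;> ring


/-! ### The position of the eigenvalues of A in the closed unit disc. -/

/-- A point `ω = ∑ pₖ μₖ` of the convex hull of three points of the unit circle, and the two
solutions `l₁`, `l₂` of `∑ pₖ / (x - μₖ) = 0` (with denominators cleared). -/
structure SpectralData (μ : Fin 3 → ℂ) (p : Fin 3 → ℝ) (ω l₁ l₂ : ℂ) : Prop where
  norm_eq : ∀ k, ‖μ k‖ = 1
  nonneg : ∀ k, 0 ≤ p k
  sum_eq : ∑ k, p k = 1
  point_eq : ω = ∑ k, (p k : ℂ) * μ k
  add_eq : l₁ + l₂ = ∑ k, μ k - ω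
  mul_eq : l₁ * l₂ = conj ω * ∏ k, μ k

/-- The Möbius map x ↦ x / (x - m) sends the unit circle to the line Re = 1/2 and the exterior of
the disc to the half-plane to its right. -/
theorem half_le_re_div {x m : ℂ} (hx : 1 ≤ ‖x‖) (hm : ‖m‖ = 1) (hne : x ≠ m) :
    1 / 2 ≤ (x / (x - m)).re := by
  have h0 : 0 < Complex.normSq (x - m) := Complex.normSq_pos.2 (sub_ne_zero.2 hne)
  have hx' : 1 ≤ x.re * x.re + x.im * x.im := by
    rw [← Complex.normSq_apply, Complex.normSq_eq_norm_sq]; nlinarith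
  have hm' : m.re * m.re + m.im * m.im = 1 := by
    rw [← Complex.normSq_apply, Complex.normSq_eq_norm_sq, hm, one_pow]
  rw [Complex.div_re, ← add_div, div_le_div_iff₀ two_pos h0, Complex.normSq_apply]
  simp only [Complex.sub_re, Complex.sub_im]
  nlinarith

namespace SpectralData

variable {μ : Fin 3 → ℂ} {p : Fin 3 → ℝ} {ω l₁ l₂ : ℂ}

theorem mul_conj (h : SpectralData μ p ω l₁ l₂) (k : Fin 3) : μ k * conj (μ k) = 1 := by
  rw [Complex.mul_conj, Complex.normSq_eq_norm_sq, h.norm_eq]; simp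

theorem charpoly_eq (h : SpectralData μ p ω l₁ l₂) (x : ℂ) :
    (x - l₁) * (x - l₂) = p 0 * ((x - μ 1) * (x - μ 2)) + p 1 * ((x - μ 0) * (x - μ 2)) +
      p 2 * ((x - μ 0) * (x - μ 1)) := by
  have h1 := h.add_eq
  have h2 := h.mul_eq
  have h3 : ((p 0 + p 1 + p 2 : ℝ) : ℂ) = 1 := by
    rw [← Fin.sum_univ_three, h.sum_eq, Complex.ofReal_one]
  rw [h.point_eq] at h1 h2
  simp only [Fin.sum_univ_three, Fin.prod_univ_three, map_add, map_mul,
    Complex.conj_ofReal] at h1 h2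
  push_cast at h3
  linear_combination (-x) * h1 + h2 + p 0 * μ 1 * μ 2 * h.mul_conj 0 +
    p 1 * μ 0 * μ 2 * h.mul_conj 1 + p 2 * μ 0 * μ 1 * h.mul_conj 2 +
    (x * (μ 0 + μ 1 + μ 2) - x ^ 2) * h3

theorem exists_eq_of_one_le_norm (h : SpectralData μ p ω l₁ l₂) {x : ℂ}
    (hx : (x - l₁) * (x - l₂) = 0) (hn : 1 ≤ ‖x‖) : ∃ k, x = μ k := by
  by_contra! hne
  rw [h.charpoly_eq] at hx
  have hd : ∀ k, x - μ k ≠ 0 := fun k => sub_ne_zero.2 (hne k)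
  -- The extra factor x makes every summand have real part at least pₖ / 2, so the sum cannot
  -- vanish.
  have hs : ∑ k, (p k : ℂ) * (x / (x - μ k)) = 0 := by
    rw [Fin.sum_univ_three]
    have := hd 0
    have := hd 1
    have := hd 2
    field_simp
    linear_combination x * hx
  have hre := congrArg Complex.re hs
  rw [Complex.re_sum] at hre
  have hle : ∑ k, p k * (1 / 2) ≤ ∑ k, ((p k : ℂ) * (x / (x - μ k))).re := by
    refine Finset.sum_le_sum fun k _ => ?_
    rw [Complex.re_ofReal_mul]
    exact mul_le_mul_of_nonneg_left (half_le_re_div hn (h.norm_eq k) (hne k)) (h.nonneg k)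
  rw [hre, ← Finset.sum_mul, h.sum_eq] at hle
  norm_num at hle

theorem norm_le_one (h : SpectralData μ p ω l₁ l₂) : ‖l₁‖ ≤ 1 := by
  by_contra! hlt
  obtain ⟨k, hk⟩ := h.exists_eq_of_one_le_norm (x := l₁) (by simp) hlt.le
  rw [hk, h.norm_eq] at hlt
  exact lt_irrefl _ hlt

theorem norm_mul_eq (h : SpectralData μ p ω l₁ l₂) : ‖l₁‖ * ‖l₂‖ = ‖ω‖ := by
  rw [← norm_mul, h.mul_eq, norm_mul, norm_prod, RCLike.norm_conj]
  simp [h.norm_eq]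

/-- A root of modulus one must be some μₖ, and the polynomial takes the value pₖ ∏_{j≠k} (μₖ - μⱼ)
there. -/
theorem norm_eq_one_iff (h : SpectralData μ p ω l₁ l₂) (hle : ‖l₂‖ ≤ ‖l₁‖) :
    ‖l₁‖ = 1 ↔ (∃ k, p k = 0) ∨ ¬ Function.Injective μ := by
  constructor
  · intro h1
    obtain ⟨k, hk⟩ := h.exists_eq_of_one_le_norm (x := l₁) (by simp) h1.ge
    by_contra! hc
    obtain ⟨hp, hinj⟩ := hc
    have h2 := h.charpoly_eq (μ k)
    rw [hk] at h2
    have hd : ∀ i j, i ≠ j → μ i - μ j ≠ 0 := fun i j hij => sub_ne_zero.2 (hinj.ne hij)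
    have hp' : ∀ k, (p k : ℂ) ≠ 0 := fun k => Complex.ofReal_ne_zero.2 (hp k)
    fin_cases k <;> simp [hp', sub_eq_zero, hinj.eq_iff] at h2
  · intro hc
    have key : ∃ k, (μ k - l₁) * (μ k - l₂) = 0 := by
      rcases hc with ⟨k, hk⟩ | hc
      · refine ⟨k, ?_⟩
        rw [h.charpoly_eq]
        fin_cases k <;> simp_all
      · rw [Function.Injective] at hc
        push Not at hc
        obtain ⟨i, j, hij, hne⟩ := hc
        refine ⟨i, ?_⟩
        rw [h.charpoly_eq]
        fin_cases i <;> fin_cases j <;> simp_all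
    obtain ⟨k, hk⟩ := key
    rcases mul_eq_zero.1 hk with hk | hk
    · rw [← sub_eq_zero.1 hk, h.norm_eq]
    · refine le_antisymm h.norm_le_one ?_
      rwa [← sub_eq_zero.1 hk, h.norm_eq] at hle

theorem norm_eq_one_and_iff (h : SpectralData μ p ω l₁ l₂) (hle : ‖l₂‖ ≤ ‖l₁‖) :
    (‖l₂‖ = 1 ∧ ‖l₁‖ = 1) ↔ ‖ω‖ = 1 := by
  rw [← h.norm_mul_eq]
  refine ⟨fun ⟨h1, h2⟩ => by rw [h1, h2, one_mul], fun h1 => ?_⟩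
  have h2 := h.norm_le_one
  have h3 := norm_nonneg l₂
  have h4 : ‖l₁‖ = 1 := by nlinarith
  exact ⟨by rwa [h4, one_mul] at h1, h4⟩

theorem eq_zero_iff (h : SpectralData μ p ω l₁ l₂) (hle : ‖l₂‖ ≤ ‖l₁‖) : l₂ = 0 ↔ ω = 0 := by
  rw [← norm_eq_zero (a := ω), ← h.norm_mul_eq]
  refine ⟨fun h1 => by simp [h1], fun h1 => ?_⟩
  rcases mul_eq_zero.1 h1 with h2 | h2
  · rw [h2] at hle
    exact norm_le_zero_iff.1 hle
  · exact norm_eq_zero.1 h2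

end SpectralData

/-! ### The elliptic ratio and the phase of l₂ / l₁. -/

theorem exists_ratio_iff {l₁ l₂ : ℂ} (h₁ : l₁ ≠ 0) (h₂ : l₂ ≠ 0) :
    (∃ r : ℝ, 0 ≤ r ∧ r < 4 ∧ (l₁ + l₂) ^ 2 / (l₁ * l₂) = r) ↔ ‖l₂‖ = ‖l₁‖ ∧ l₁ ≠ l₂ := by
  have hnorm : ‖l₂‖ = ‖l₁‖ ↔ ‖l₂ / l₁‖ = 1 := by
    rw [norm_div, div_eq_one_iff_eq (norm_ne_zero_iff.2 h₁)]
  have hne : l₁ ≠ l₂ ↔ l₂ / l₁ ≠ 1 := by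
    rw [Ne, Ne, div_eq_one_iff_eq h₁, eq_comm]
  have hR : (l₁ + l₂) ^ 2 / (l₁ * l₂) = (1 + l₂ / l₁) ^ 2 / (l₂ / l₁) := by field_simp
  have hq0 : l₂ / l₁ ≠ 0 := div_ne_zero h₂ h₁
  rw [hnorm, hne, hR]
  generalize l₂ / l₁ = q at hq0
  have hn : ‖q‖ = 1 ↔ q.re * q.re + q.im * q.im = 1 := by
    rw [← Complex.normSq_apply, Complex.normSq_eq_norm_sq,
      pow_eq_one_iff_of_nonneg (norm_nonneg _) two_ne_zero]
  rw [hn]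
  constructor
  · rintro ⟨r, hr0, hr4, hr⟩
    rw [div_eq_iff hq0] at hr
    have hre := congrArg Complex.re hr
    have him := congrArg Complex.im hr
    simp [pow_two] at hre him
    have hne1 : q ≠ 1 := by
      rintro rfl
      simp at hre
      linarith
    refine ⟨?_, hne1⟩
    -- q solves q² + (2 - r) q + 1 = 0, whose discriminant r (r - 4) is not positive. A real
    -- solution forces r = 0 and q = -1; otherwise the imaginary part gives r = 2 (1 + Re q), and
    -- the real part becomes |q| = 1.
    by_cases hy : q.im = 0
    · rw [hy] at hre ⊢
      have h1 : (q.re + (2 - r) / 2) ^ 2 + r * (4 - r) / 4 = 0 := by linarith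
      have h2 : 0 ≤ r * (4 - r) := mul_nonneg hr0 (by linarith)
      have h3 : q.re + (2 - r) / 2 = 0 := by
        have := sq_nonneg (q.re + (2 - r) / 2)
        exact pow_eq_zero_iff two_ne_zero |>.1 (by linarith)
      have h4 : r * (4 - r) = 0 := by rw [h3] at h1; linarith
      rcases mul_eq_zero.1 h4 with h5 | h5
      · have : q.re = -1 := by linarith
        rw [this]; norm_num
      · linarith
    · have h1 : 2 * (1 + q.re) = r := by
        apply mul_right_cancel₀ hy
        linarith
      rw [← h1] at hre
      linarith
  · rintro ⟨h1, h2⟩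
    have h3 : q.re < 1 := by
      by_contra! h4
      apply h2
      have h6 : q.re = 1 := by nlinarith [mul_self_nonneg q.im]
      have h5 : q.im = 0 := by rw [h6] at h1; exact mul_self_eq_zero.1 (by linarith)
      exact Complex.ext h6 h5
    refine ⟨2 + 2 * q.re, ?_, by linarith, ?_⟩
    · nlinarith [mul_self_nonneg q.im]
    · rw [div_eq_iff hq0]
      apply Complex.ext <;> simp [pow_two]
      · linarith
      · ring

/-- This is |1 + exp(iψ)| = 2 cos(ψ/2); the absolute value puts the half-angle in [0, π/2], where
`arccos` inverts the cosine. -/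
theorem arccos_ratio_eq {l₁ l₂ : ℂ} (h₁ : l₁ ≠ 0) (h : ‖l₂‖ = ‖l₁‖) :
    Real.arccos (‖l₁ + l₂‖ / (2 * √(‖l₁‖ * ‖l₂‖))) = |Complex.arg (l₂ / l₁)| / 2 := by
  set ψ := Complex.arg (l₂ / l₁) with hψ
  have hn1 : ‖l₁‖ ≠ 0 := norm_ne_zero_iff.2 h₁
  have hq : ‖l₂ / l₁‖ = 1 := by rw [norm_div, h, div_self hn1]
  have hcos : Real.cos ψ = (l₂ / l₁).re := by
    have := Complex.norm_mul_cos_arg (l₂ / l₁)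
    rwa [hq, one_mul] at this
  have hψle : |ψ| ≤ Real.pi := Complex.abs_arg_le_pi _
  have hψ0 := abs_nonneg ψ
  have hq' : (l₂ / l₁).re * (l₂ / l₁).re + (l₂ / l₁).im * (l₂ / l₁).im = 1 := by
    rw [← Complex.normSq_apply, Complex.normSq_eq_norm_sq, hq, one_pow]
  have hsq : ‖1 + l₂ / l₁‖ = 2 * Real.cos (|ψ| / 2) := by
    have hc : 0 ≤ Real.cos (|ψ| / 2) :=
      Real.cos_nonneg_of_mem_Icc ⟨by linarith [Real.pi_pos], by linarith⟩
    rw [← sq_eq_sq₀ (norm_nonneg _) (by positivity), ← Complex.normSq_eq_norm_sq,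
      Complex.normSq_apply, mul_pow, Real.cos_sq, mul_div_cancel₀ _ two_ne_zero, Real.cos_abs, hcos]
    simp only [Complex.add_re, Complex.add_im, Complex.one_re, Complex.one_im]
    linarith
  have hfac : l₁ + l₂ = l₁ * (1 + l₂ / l₁) := by field_simp
  rw [hfac, norm_mul, hsq, h, Real.sqrt_mul_self (norm_nonneg _)]
  rw [show ‖l₁‖ * (2 * Real.cos (|ψ| / 2)) / (2 * ‖l₁‖) = Real.cos (|ψ| / 2) by field_simp]
  exact Real.arccos_cos (by linarith) (by linarith)

theorem isPiRat_abs_div_two {x : ℝ} : IsPiRat (|x| / 2) ↔ IsPiRat x := by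
  constructor
  · rintro ⟨q, hq⟩
    rcases abs_choice x with h | h <;> rw [h] at hq
    · exact ⟨2 * q, by push_cast; linarith⟩
    · exact ⟨-(2 * q), by push_cast; linarith⟩
  · rintro ⟨q, hq⟩
    rcases abs_choice x with h | h <;> rw [h, hq]
    · exact ⟨q / 2, by push_cast; ring⟩
    · exact ⟨-(q / 2), by push_cast; ring⟩

theorem arg_div_eq_zero_iff {l₁ l₂ : ℂ} (h₁ : l₁ ≠ 0) (h : ‖l₂‖ = ‖l₁‖) :
    Complex.arg (l₂ / l₁) = 0 ↔ l₁ = l₂ := by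
  constructor
  · intro h0
    have h2 := Complex.norm_mul_exp_arg_mul_I (l₂ / l₁)
    rw [h0, norm_div, h, div_self (norm_ne_zero_iff.2 h₁)] at h2
    have h3 : l₂ / l₁ = 1 := by rw [← h2]; simp
    exact ((div_eq_one_iff_eq h₁).1 h3).symm
  · rintro rfl
    rw [div_self h₁, Complex.arg_one]

theorem arg_div_eq_pi_iff {l₁ l₂ : ℂ} (h₁ : l₁ ≠ 0) (h : ‖l₂‖ = ‖l₁‖) :
    Complex.arg (l₂ / l₁) = Real.pi ↔ l₁ + l₂ = 0 := by
  constructor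
  · intro h0
    have h2 := Complex.norm_mul_exp_arg_mul_I (l₂ / l₁)
    rw [h0, norm_div, h, div_self (norm_ne_zero_iff.2 h₁), Complex.exp_pi_mul_I] at h2
    have h3 : l₂ = l₂ / l₁ * l₁ := (div_mul_cancel₀ _ h₁).symm
    rw [h3, ← h2]; simp
  · intro h0
    have : l₂ / l₁ = -1 := by rw [div_eq_iff h₁]; linear_combination h0
    rw [this, Complex.arg_neg_one]


/-! ### Interior and boundary of the hull of three points of the circle. -/

theorem affineSpan_ne_top_of_not_injective {μ : Fin 3 → ℂ} (h : ¬ Function.Injective μ) :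
    affineSpan ℝ (Set.range μ) ≠ ⊤ := by
  intro htop
  have hex : ∃ a b, Set.range μ ⊆ {a, b} := by
    rw [Function.Injective] at h
    push Not at h
    obtain ⟨i, j, hij, hne⟩ := h
    have : ∃ k, ∀ m, m = i ∨ m = k ∨ m = j := by clear hij; decide +revert
    obtain ⟨k, hk⟩ := this
    refine ⟨μ i, μ k, ?_⟩
    rintro _ ⟨m, rfl⟩
    rcases hk m with rfl | rfl | rfl <;> simp [hij]
  obtain ⟨a, b, hab⟩ := hex
  have h1 : affineSpan ℝ ({a, b} : Set ℂ) = ⊤ := top_le_iff.1 (htop ▸ affineSpan_mono ℝ hab)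
  have h2 := (collinear_pair ℝ a b).finrank_le_one
  rw [← direction_affineSpan, h1, AffineSubspace.direction_top, finrank_top,
    Complex.finrank_real_complex] at h2
  norm_num at h2

theorem injective_of_interior_nonempty {μ : Fin 3 → ℂ}
    (h : (interior (convexHull ℝ (Set.range μ))).Nonempty) : Function.Injective μ := by
  by_contra hc
  exact affineSpan_ne_top_of_not_injective hc
    (interior_convexHull_nonempty_iff_affineSpan_eq_top.1 h)

theorem affineIndependent_of_norm_eq_one {μ : Fin 3 → ℂ} (hμ : ∀ k, ‖μ k‖ = 1)
    (hinj : Function.Injective μ) : AffineIndependent ℝ μ :=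
  EuclideanGeometry.Cospherical.affineIndependent (s := Set.range μ)
    ⟨0, 1, by rintro _ ⟨k, rfl⟩; simpa using hμ k⟩ subset_rfl hinj

theorem affineSpan_eq_top_of_affineIndependent {m : Fin 3 → ℂ} (h : AffineIndependent ℝ m) :
    affineSpan ℝ (Set.range m) = ⊤ :=
  h.affineSpan_eq_top_iff_card_eq_finrank_add_one.2 (by simp [Complex.finrank_real_complex])

namespace SpectralData

variable {μ : Fin 3 → ℂ} {p : Fin 3 → ℝ} {ω l₁ l₂ : ℂ}

theorem mem_convexHull (h : SpectralData μ p ω l₁ l₂) : ω ∈ convexHull ℝ (Set.range μ) := by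
  have h1 : ω = ∑ k, p k • μ k := by simp [h.point_eq]
  rw [h1]
  exact (convex_convexHull ℝ _).sum_mem (fun k _ => h.nonneg k) h.sum_eq
    fun k _ => subset_convexHull ℝ _ ⟨k, rfl⟩

/-- Distinct points of a circle are affinely independent, so the pₖ are the barycentric coordinates
of ω, and the interior is where all are positive. If two points coincide, the interior is empty. -/
theorem mem_interior_iff (h : SpectralData μ p ω l₁ l₂) :
    ω ∈ interior (convexHull ℝ (Set.range μ)) ↔ (∀ k, p k ≠ 0) ∧ Function.Injective μ := by
  by_cases hinj : Function.Injective μ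
  · have hai := affineIndependent_of_norm_eq_one h.norm_eq hinj
    let b : AffineBasis (Fin 3) ℝ ℂ := ⟨μ, hai, affineSpan_eq_top_of_affineIndependent hai⟩
    have hb : interior (convexHull ℝ (Set.range μ)) = {x | ∀ i, 0 < b.coord i x} :=
      b.interior_convexHull
    have hω : ω = Finset.univ.affineCombination ℝ b p := by
      rw [Finset.affineCombination_eq_linear_combination _ _ _ h.sum_eq, h.point_eq]
      simp [show ⇑b = μ from rfl]
    rw [hb, hω]
    simp only [Set.mem_ofPred_eq, b.coord_apply_combination_of_mem (Finset.mem_univ _) h.sum_eq]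
    exact ⟨fun h1 => ⟨fun k => (h1 k).ne', hinj⟩,
      fun h1 k => lt_of_le_of_ne (h.nonneg k) (h1.1 k).symm⟩
  · exact ⟨fun h1 => absurd (injective_of_interior_nonempty ⟨_, h1⟩) hinj,
      fun h1 => absurd h1.2 hinj⟩

theorem mem_interior_iff_norm_lt_one (h : SpectralData μ p ω l₁ l₂) (hle : ‖l₂‖ ≤ ‖l₁‖) :
    ω ∈ interior (convexHull ℝ (Set.range μ)) ↔ ‖l₁‖ < 1 := by
  rw [h.norm_le_one.lt_iff_ne, Ne, h.norm_eq_one_iff hle, h.mem_interior_iff]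
  push Not
  rfl

theorem mem_frontier_iff (h : SpectralData μ p ω l₁ l₂) (hle : ‖l₂‖ ≤ ‖l₁‖) :
    ω ∈ frontier (convexHull ℝ (Set.range μ)) ↔ ‖l₁‖ = 1 := by
  have hc : IsClosed (convexHull ℝ (Set.range μ)) :=
    (Set.finite_range μ).isClosed_convexHull ℝ
  rw [hc.frontier_eq, Set.mem_sdiff, h.mem_interior_iff_norm_lt_one hle, not_lt]
  exact ⟨fun h1 => le_antisymm h.norm_le_one h1.2, fun h1 => ⟨h.mem_convexHull, h1.ge⟩⟩

end SpectralData

/-! ### Triangles inscribed in the unit circle. -/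

section UnitCircle

variable {μ : Fin 3 → ℂ}

theorem convexHull_subset_closedBall (hμ : ∀ k, ‖μ k‖ = 1) :
    convexHull ℝ (Set.range μ) ⊆ Metric.closedBall 0 1 := by
  refine convexHull_min ?_ (convex_closedBall 0 1)
  rintro _ ⟨k, rfl⟩
  simp [hμ]

/-- Points of the unit circle in the convex hull of points of the closed disc are among them. -/
theorem mem_of_mem_convexHull_of_norm_eq_one {s : Set ℂ} {a : ℂ}
    (hs : convexHull ℝ s ⊆ Metric.closedBall 0 1) (ha : a ∈ convexHull ℝ s) (h1 : ‖a‖ = 1) :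
    a ∈ s := by
  have h2 : a ∈ Set.extremePoints ℝ (Metric.closedBall (0 : ℂ) 1) :=
    StrictConvexSpace.sphere_subset_extremePoints_closedBall 0 one_ne_zero (by simpa using h1)
  exact extremePoints_convexHull_subset
    (inter_extremePoints_subset_extremePoints_of_subset hs ⟨ha, h2⟩)

/-- The μₖ are extreme points of the disc, hence vertices of `t`; the interior of a triangle is
non-empty, so they are distinct and exhaust the vertices. -/
theorem exists_perm_of_isTriangle (hμ : ∀ k, ‖μ k‖ = 1) {t : Affine.Triangle ℝ ℂ}
    (ht : IsTriangle (convexHull ℝ (Set.range μ)) t) :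
    ∃ e : Equiv.Perm (Fin 3), ∀ k, t.points (e k) = μ k := by
  have hinj : Function.Injective μ := by
    apply injective_of_interior_nonempty
    rw [ht, interior_convexHull_nonempty_iff_affineSpan_eq_top]
    exact affineSpan_eq_top_of_affineIndependent t.independent
  have hsub : ∀ k, ∃ i, t.points i = μ k := by
    intro k
    refine mem_of_mem_convexHull_of_norm_eq_one (s := Set.range t.points) ?_ ?_ (hμ k)
    · rw [← ht]; exact convexHull_subset_closedBall hμ
    · rw [← ht]; exact subset_convexHull ℝ _ ⟨k, rfl⟩
  choose f hf using hsub
  have hfi : Function.Injective f := fun i j hij => hinj (by rw [← hf, ← hf, hij])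
  exact ⟨Equiv.ofBijective f (Finite.injective_iff_bijective.1 hfi), hf⟩

theorem mul_conj_eq_one {a : ℂ} (h : ‖a‖ = 1) : a * conj a = 1 := by
  rw [Complex.mul_conj, Complex.normSq_eq_norm_sq, h]; simp

/-- The left side is e₁ e₂ - e₃ in elementary symmetric functions, and e₂ = e₃ ē₁ on the unit
circle. Thus |e₁| = 1 detects antipodal pairs. -/
theorem prod_add_eq (hμ : ∀ k, ‖μ k‖ = 1) :
    (μ 0 + μ 1) * (μ 1 + μ 2) * (μ 2 + μ 0) =
      (∏ k, μ k) * (((‖∑ k, μ k‖ ^ 2 : ℝ) : ℂ) - 1) := by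
  rw [← Complex.normSq_eq_norm_sq, ← Complex.mul_conj]
  simp only [Fin.sum_univ_three, Fin.prod_univ_three, map_add]
  linear_combination (-(μ 0 + μ 1 + μ 2) * μ 1 * μ 2) * mul_conj_eq_one (hμ 0)
    - (μ 0 + μ 1 + μ 2) * μ 0 * μ 2 * mul_conj_eq_one (hμ 1)
    - (μ 0 + μ 1 + μ 2) * μ 0 * μ 1 * mul_conj_eq_one (hμ 2)

theorem norm_sum_eq_one_iff (hμ : ∀ k, ‖μ k‖ = 1) :
    ‖∑ k, μ k‖ = 1 ↔ ∃ i k, i ≠ k ∧ μ i + μ k = 0 := by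
  have h := prod_add_eq hμ
  have h0 : ∏ k, μ k ≠ 0 := by
    rw [← norm_ne_zero_iff, norm_prod]
    simp [hμ]
  constructor
  · intro h1
    rw [h1] at h
    simp only [one_pow, Complex.ofReal_one, sub_self, mul_zero, mul_eq_zero] at h
    rcases h with (h | h) | h
    · exact ⟨0, 1, by decide, h⟩
    · exact ⟨1, 2, by decide, h⟩
    · exact ⟨2, 0, by decide, h⟩
  · rintro ⟨i, k, hne, hik⟩
    have h2 : (μ 0 + μ 1) * (μ 1 + μ 2) * (μ 2 + μ 0) = 0 := by
      clear h h0
      fin_cases i <;> fin_cases k <;> grind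
    rw [h2, eq_comm, mul_eq_zero, or_iff_right h0, sub_eq_zero] at h
    have h3 : ‖∑ k, μ k‖ ^ 2 = 1 := by exact_mod_cast h
    exact (pow_eq_one_iff_of_nonneg (norm_nonneg _) two_ne_zero).1 h3

/-- An algebraic form of Thales' theorem, obtained by replacing conjugates by inverses: the angle at
b is right iff a and c are antipodal. -/
theorem two_mul_inner_sub_sub {a b c : ℂ} (ha : ‖a‖ = 1) (hb : ‖b‖ = 1) (hc : ‖c‖ = 1) :
    ((2 * inner ℝ (a - b) (c - b) : ℝ) : ℂ) * (a * b * c) = (a - b) * (b - c) * (a + c) := by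
  have ha' := mul_conj_eq_one ha
  have hb' := mul_conj_eq_one hb
  have hc' := mul_conj_eq_one hc
  have h : ((2 * inner ℝ (a - b) (c - b) : ℝ) : ℂ) =
      conj (a - b) * (c - b) + (a - b) * conj (c - b) := by
    have h1 : inner ℝ (a - b) (c - b) = (conj (a - b) * (c - b)).re := by
      rw [Complex.inner, mul_comm]
    rw [h1, ← Complex.add_conj]
    simp
  rw [h]
  simp only [map_sub]
  linear_combination (c - b) * b * c * ha' - (c - b) * a * c * hb' + (a - b) * a * b * hc'
    - (a - b) * a * c * hb'

theorem angle_eq_pi_div_two_iff {a b c : ℂ} (ha : ‖a‖ = 1) (hb : ‖b‖ = 1) (hc : ‖c‖ = 1)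
    (hab : a ≠ b) (hbc : b ≠ c) : EuclideanGeometry.angle a b c = Real.pi / 2 ↔ a + c = 0 := by
  have h := two_mul_inner_sub_sub ha hb hc
  have h0 : ∀ {x : ℂ}, ‖x‖ = 1 → x ≠ 0 := fun {x} hx =>
    norm_ne_zero_iff.1 (by rw [hx]; exact one_ne_zero)
  rw [EuclideanGeometry.angle, ← InnerProductGeometry.inner_eq_zero_iff_angle_eq_pi_div_two,
    vsub_eq_sub, vsub_eq_sub]
  constructor
  · intro h1
    rw [h1, mul_zero, Complex.ofReal_zero, zero_mul, eq_comm] at h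
    simpa [sub_eq_zero, hab, hbc] using h
  · intro h1
    rw [h1, mul_zero] at h
    simp only [mul_eq_zero, Complex.ofReal_eq_zero, h0 ha, h0 hb, h0 hc, or_false] at h
    exact h.resolve_left two_ne_zero

theorem angle_lt_pi_div_two {x y : ℂ} (h : 0 < inner ℝ x y) :
    InnerProductGeometry.angle x y < Real.pi / 2 := by
  rw [InnerProductGeometry.angle, Real.arccos_lt_pi_div_two]
  refine div_pos h (mul_pos (norm_pos_iff.2 ?_) (norm_pos_iff.2 ?_))
  · rintro rfl; simp at h
  · rintro rfl; simp at h

theorem norm_sub_eq_iff_add_eq_zero (hμ : ∀ k, ‖μ k‖ = 1) (hinj : Function.Injective μ) :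
    (dist (μ 0) (μ 1) = dist (μ 0) (μ 2) ∧ dist (μ 0) (μ 1) = dist (μ 1) (μ 2)) ↔
      ∑ k, μ k = 0 := by
  have h01 : μ 0 - μ 1 ≠ 0 := sub_ne_zero.2 (hinj.ne (by decide))
  have h02 : μ 0 - μ 2 ≠ 0 := sub_ne_zero.2 (hinj.ne (by decide))
  -- Squared chords become polynomial in the endpoints, so that equal sides give algebraic
  -- equations; the factors μᵢ - μⱼ can be cancelled.
  have key : ∀ a b : ℂ, ‖a‖ = 1 → ‖b‖ = 1 → ((dist a b ^ 2 : ℝ) : ℂ) * (a * b) = -(a - b) ^ 2 := by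
    intro a b ha hb
    rw [dist_eq_norm, ← Complex.normSq_eq_norm_sq, ← Complex.mul_conj, map_sub]
    linear_combination (a - b) * b * mul_conj_eq_one ha - (a - b) * a * mul_conj_eq_one hb
  have k01 := key _ _ (hμ 0) (hμ 1)
  have k02 := key _ _ (hμ 0) (hμ 2)
  have k12 := key _ _ (hμ 1) (hμ 2)
  rw [Fin.sum_univ_three]
  constructor
  · rintro ⟨h1, h2⟩
    rw [← h1] at k02
    rw [← h2] at k12
    have e1 : (μ 1 - μ 2) * (μ 0 ^ 2 - μ 1 * μ 2) = 0 := by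
      linear_combination μ 1 * k02 - μ 2 * k01
    have e2 : (μ 0 - μ 2) * (μ 1 ^ 2 - μ 0 * μ 2) = 0 := by
      linear_combination μ 0 * k12 - μ 2 * k01
    have h12 : μ 1 - μ 2 ≠ 0 := sub_ne_zero.2 (hinj.ne (by decide))
    have f1 := (mul_eq_zero.1 e1).resolve_left h12
    have f2 := (mul_eq_zero.1 e2).resolve_left h02
    have : (μ 0 - μ 1) * (μ 0 + μ 1 + μ 2) = 0 := by linear_combination f1 - f2
    exact (mul_eq_zero.1 this).resolve_left h01
  · intro hs
    -- By the parallelogram law, |a - b|² = 4 - |a + b|² = 4 - |c|² = 3.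
    have par : ∀ a b c : ℂ, ‖a‖ = 1 → ‖b‖ = 1 → ‖c‖ = 1 → a + b + c = 0 → dist a b ^ 2 = 3 := by
      intro a b c ha hb hc h
      have h1 := parallelogram_law_with_norm ℝ a b
      have h2 : a + b = -c := by linear_combination h
      rw [h2, norm_neg, ha, hb, hc] at h1
      rw [dist_eq_norm]
      linarith
    have p01 := par _ _ _ (hμ 0) (hμ 1) (hμ 2) hs
    have p02 := par _ _ _ (hμ 0) (hμ 2) (hμ 1) (by linear_combination hs)
    have p12 := par _ _ _ (hμ 1) (hμ 2) (hμ 0) (by linear_combination hs)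
    exact ⟨(sq_eq_sq₀ dist_nonneg dist_nonneg).1 (by rw [p01, p02]),
      (sq_eq_sq₀ dist_nonneg dist_nonneg).1 (by rw [p01, p12])⟩

end UnitCircle

/-! ### Null chains: the shape of W(U) when ω = 0. -/

namespace SpectralData

variable {μ : Fin 3 → ℂ} {p : Fin 3 → ℝ} {l₁ l₂ : ℂ}

/-- The circumcentre 0 lies in the hull, so no angle is obtuse, and right angles come from antipodal
points. The inner product equals (1 + a) - (b + c), with a, b, c as set in the proof; pairing ∑ pₘ
μₘ = 0 with μᵢ and μₖ and adding shows b + c ≤ 0. -/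
theorem inner_sub_sub_pos (h : SpectralData μ p 0 l₁ l₂) {i j k : Fin 3} (hij : i ≠ j)
    (hik : i ≠ k) (hjk : j ≠ k) (hne : μ i + μ k ≠ 0) :
    0 < inner ℝ (μ i - μ j) (μ k - μ j) := by
  have hn : ∀ m, inner ℝ (μ m) (μ m) = (1 : ℝ) := by
    intro m; rw [real_inner_self_eq_norm_sq, h.norm_eq, one_pow]
  have hsum : ∀ f : Fin 3 → ℂ, ∑ m, f m = f i + f j + f k := by
    intro f
    rw [Fin.sum_univ_three]
    fin_cases i <;> fin_cases j <;> fin_cases k <;> simp_all <;> ring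
  have hsum' : p i + p j + p k = 1 := by
    have h1 := hsum fun m => (p m : ℂ)
    rw [← Complex.ofReal_sum, h.sum_eq] at h1
    exact_mod_cast h1.symm
  have hz : p i • μ i + p j • μ j + p k • μ k = 0 := by
    have h1 := h.point_eq
    rw [hsum] at h1
    simpa using h1.symm
  have hi := congrArg (fun x => inner ℝ x (μ i) : ℂ → ℝ) hz
  have hk := congrArg (fun x => inner ℝ x (μ k) : ℂ → ℝ) hz
  simp only [inner_add_left, real_inner_smul_left, inner_zero_left, hn] at hi hk
  have hpos : 0 < 1 + inner ℝ (μ i) (μ k) := by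
    have h1 : 0 < inner ℝ (μ i + μ k) (μ i + μ k) := real_inner_self_pos.2 hne
    rw [inner_add_left, inner_add_right, inner_add_right, hn, hn, real_inner_comm (μ i) (μ k)] at h1
    rw [real_inner_comm] at h1 ⊢
    linarith
  have e1 : inner ℝ (μ k) (μ i) = inner ℝ (μ i) (μ k) := real_inner_comm _ _
  have e2 : inner ℝ (μ j) (μ i) = inner ℝ (μ i) (μ j) := real_inner_comm _ _
  rw [inner_sub_left, inner_sub_right, inner_sub_right, hn]
  rw [e1, e2] at hi
  set a : ℝ := inner ℝ (μ i) (μ k)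
  set b : ℝ := inner ℝ (μ i) (μ j)
  set c : ℝ := inner ℝ (μ j) (μ k)
  have h3 : p j * (b + c) = -((p i + p k) * (1 + a)) := by linarith
  have hpi := h.nonneg i
  have hpj := h.nonneg j
  have hpk := h.nonneg k
  have hpj0 : 0 < p j := by
    refine lt_of_le_of_ne hpj fun h0 => ?_
    rw [← h0] at h3 hsum'
    have : p i + p k = 1 := by linarith
    rw [this] at h3
    linarith
  have h4 : b + c ≤ 0 := by
    by_contra! h5
    have := mul_pos hpj0 h5
    have := mul_nonneg (add_nonneg hpi hpk) hpos.le
    linarith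
  linarith

theorem sum_eq_left (h : SpectralData μ p 0 l₁ 0) : ∑ k, μ k = l₁ := by
  simpa using h.add_eq.symm

theorem injective_of_norm_ne_one (h : SpectralData μ p 0 l₁ 0) (h1 : ‖l₁‖ ≠ 1) :
    Function.Injective μ := by
  by_contra hc
  exact h1 ((h.norm_eq_one_iff (by simp)).2 (Or.inr hc))

theorem isEquilateral_iff (h : SpectralData μ p 0 l₁ 0) :
    IsEquilateral (convexHull ℝ (Set.range μ)) ↔ l₁ = 0 := by
  rw [← h.sum_eq_left]
  constructor
  · rintro ⟨t, ht, heq⟩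
    obtain ⟨e, he⟩ := exists_perm_of_isTriangle h.norm_eq ht
    have hinj : Function.Injective μ := by
      intro i j hij
      rw [← he, ← he] at hij
      exact e.injective (t.independent.injective hij)
    rw [← norm_sub_eq_iff_add_eq_zero h.norm_eq hinj, ← he, ← he, ← he]
    exact ⟨heq.dist_eq (e.injective.ne (by decide)) (e.injective.ne (by decide)),
      heq.dist_eq (e.injective.ne (by decide)) (e.injective.ne (by decide))⟩
  · intro hs
    have hinj := h.injective_of_norm_ne_one (by rw [← h.sum_eq_left, hs]; simp)
    let t : Affine.Triangle ℝ ℂ := ⟨μ, affineIndependent_of_norm_eq_one h.norm_eq hinj⟩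
    exact ⟨t, rfl, Affine.Triangle.equilateral_iff_dist_01_eq_02_and_dist_01_eq_12.2
      ((norm_sub_eq_iff_add_eq_zero h.norm_eq hinj).2 hs)⟩

theorem isRightAngled_or_isDiameter_iff (h : SpectralData μ p 0 l₁ 0) :
    (IsRightAngled (convexHull ℝ (Set.range μ)) ∨ IsDiameter (convexHull ℝ (Set.range μ))) ↔
      ‖l₁‖ = 1 := by
  rw [← h.sum_eq_left, norm_sum_eq_one_iff h.norm_eq]
  constructor
  · rintro (⟨t, ht, i, j, k, hij, hjk, hki, hang⟩ | ⟨a, ha, hseg⟩)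
    · obtain ⟨e, he⟩ := exists_perm_of_isTriangle h.norm_eq ht
      have hn : ∀ m, ‖t.points m‖ = 1 := by
        intro m
        have := he (e.symm m)
        rw [Equiv.apply_symm_apply] at this
        rw [this, h.norm_eq]
      have hadd := (angle_eq_pi_div_two_iff (hn i) (hn j) (hn k) (t.independent.injective.ne hij)
        (t.independent.injective.ne hjk)).1 hang
      refine ⟨e.symm i, e.symm k, e.symm.injective.ne hki.symm, ?_⟩
      rw [← he, ← he, Equiv.apply_symm_apply, Equiv.apply_symm_apply, hadd]
    · have hmem : ∀ x, ‖x‖ = 1 → x ∈ segment ℝ (-a) a → x ∈ Set.range μ := fun x hx hxs =>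
        mem_of_mem_convexHull_of_norm_eq_one (convexHull_subset_closedBall h.norm_eq)
          (by rwa [hseg]) hx
      obtain ⟨i, hi⟩ := hmem a ha (right_mem_segment ℝ _ _)
      obtain ⟨k, hk⟩ := hmem (-a) (by rwa [norm_neg]) (left_mem_segment ℝ _ _)
      refine ⟨i, k, ?_, by rw [hi, hk, add_neg_cancel]⟩
      rintro rfl
      have : a = 0 := self_eq_neg.1 (hi.symm.trans hk)
      simp [this] at ha
  · rintro ⟨i, k, hik, hadd⟩
    obtain ⟨j, hij, hjk, hall⟩ : ∃ j : Fin 3, i ≠ j ∧ j ≠ k ∧ ∀ m, m = i ∨ m = j ∨ m = k := by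
      clear hadd; decide +revert
    by_cases hinj : Function.Injective μ
    · left
      let t : Affine.Triangle ℝ ℂ := ⟨μ, affineIndependent_of_norm_eq_one h.norm_eq hinj⟩
      exact ⟨t, rfl, i, j, k, hij, hjk, hik.symm, (angle_eq_pi_div_two_iff (h.norm_eq i)
        (h.norm_eq j) (h.norm_eq k) (hinj.ne hij) (hinj.ne hjk)).2 hadd⟩
    -- With a repeated eigenvalue, μⱼ is one of the two antipodal points, and the hull is the
    -- segment between them.
    · right
      have hk : μ k = -μ i := by linear_combination hadd
      have hne : μ i ≠ μ k := by
        rw [hk]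
        intro h0
        have h1 := h.norm_eq i
        rw [self_eq_neg.1 h0, norm_zero] at h1
        exact zero_ne_one h1
      have hj : μ j = μ i ∨ μ j = μ k := by
        by_contra! hc
        apply hinj
        intro a b hab
        rcases hall a with rfl | rfl | rfl <;> rcases hall b with rfl | rfl | rfl <;>
          grind
      refine ⟨μ i, h.norm_eq i, ?_⟩
      rw [← convexHull_pair, ← hk]
      congr 1
      ext x
      constructor
      · rintro ⟨m, rfl⟩
        rcases hall m with rfl | rfl | rfl
        · simp
        · rcases hj with h1 | h1 <;> simp [h1]
        · simp
      · rintro (rfl | rfl)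
        · exact ⟨k, rfl⟩
        · exact ⟨i, rfl⟩

theorem isAcuteNonEquilateral_iff (h : SpectralData μ p 0 l₁ 0) :
    IsAcuteNonEquilateral (convexHull ℝ (Set.range μ)) ↔ 0 < ‖l₁‖ ∧ ‖l₁‖ < 1 := by
  constructor
  · rintro ⟨t, ht, hac, hne⟩
    constructor
    · rw [norm_pos_iff]
      intro h0
      obtain ⟨e, he⟩ := exists_perm_of_isTriangle h.norm_eq ht
      -- The equilateral triangle `s` may differ from `t` by its labelling; both have the μₖ as
      -- vertices, so equal sides transfer.
      obtain ⟨s, hs, r, hr⟩ := h.isEquilateral_iff.2 h0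
      obtain ⟨e', he'⟩ := exists_perm_of_isTriangle h.norm_eq hs
      refine hne ⟨r, fun i j hij => ?_⟩
      have h1 := he (e.symm i)
      have h2 := he (e.symm j)
      rw [Equiv.apply_symm_apply] at h1 h2
      rw [h1, h2, ← he', ← he']
      exact hr _ _ (e'.injective.ne (e.symm.injective.ne hij))
    · refine lt_of_le_of_ne h.norm_le_one fun h1 => ?_
      rw [← h.sum_eq_left, norm_sum_eq_one_iff h.norm_eq] at h1
      obtain ⟨i, k, hik, hadd⟩ := h1
      obtain ⟨j, hij, hjk⟩ : ∃ j : Fin 3, i ≠ j ∧ j ≠ k := by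
        clear hadd; decide +revert
      obtain ⟨e, he⟩ := exists_perm_of_isTriangle h.norm_eq ht
      have hlt := hac (e i) (e j) (e k) (e.injective.ne hij) (e.injective.ne hik)
        (e.injective.ne hjk)
      have hinj : Function.Injective μ := by
        intro i j hij
        rw [← he, ← he] at hij
        exact e.injective (t.independent.injective hij)
      rw [he, he, he, (angle_eq_pi_div_two_iff (h.norm_eq i) (h.norm_eq j) (h.norm_eq k)
        (hinj.ne hij) (hinj.ne hjk)).2 hadd] at hlt
      exact lt_irrefl _ hlt
  · rintro ⟨h0, h1⟩
    have hinj := h.injective_of_norm_ne_one h1.ne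
    let t : Affine.Triangle ℝ ℂ := ⟨μ, affineIndependent_of_norm_eq_one h.norm_eq hinj⟩
    refine ⟨t, rfl, ?_, ?_⟩
    · intro i j k hij hik hjk
      refine angle_lt_pi_div_two (h.inner_sub_sub_pos hij hik hjk fun hadd => h1.ne ?_)
      rw [← h.sum_eq_left, norm_sum_eq_one_iff h.norm_eq]
      exact ⟨i, k, hik, hadd⟩
    · intro heq
      have := h.isEquilateral_iff.1 ⟨t, rfl, heq⟩
      rw [this, norm_zero] at h0
      exact lt_irrefl _ h0

end SpectralData


/-! ### From eigenvalue cases to conditions on ω. -/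

theorem exists_ordered_roots (U : Hilb 3 →ₗ[ℂ] Hilb 3) {z : Hilb 3} (hz : ‖z‖ = 1) :
    ∃ l₁ l₂ : ℂ, (ballOperator U z).charpoly.roots = {l₁, l₂} ∧ ‖l₂‖ ≤ ‖l₁‖ := by
  obtain ⟨a, b, h⟩ := exists_roots_charpoly_eq_pair (finrank_orthogonal_eq_two hz)
    (ballOperator U z)
  rcases le_total ‖b‖ ‖a‖ with hab | hab
  · exact ⟨a, b, h, hab⟩
  · exact ⟨b, a, h.trans (Multiset.pair_comm a b), hab⟩

/-- The ordering of the roots is not unique when their moduli agree, so the criterion is required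
for every admissible ordering. -/
theorem generatesChain_iff_of_forall {U : unitary (Hilb 3 →ₗ[ℂ] Hilb 3)} {z : Hilb 3}
    (hz : ‖z‖ = 1) {F : PIFS (State 3) 2} (hF : F = pifs U (ballPointPVM z hz)) {t : ChainType}
    {C : Prop} (h : ∀ l₁ l₂ : ℂ, (ballOperator U.1 z).charpoly.roots = {l₁, l₂} → ‖l₂‖ ≤ ‖l₁‖ →
      (t.Case l₁ l₂ ↔ C)) : F.GeneratesChain t ↔ C := by
  rw [generatesChain_iff hz hF]
  constructor
  · rintro ⟨l₁, l₂, hr, hle, ht⟩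
    exact (h l₁ l₂ hr hle).1 ht
  · intro hC
    obtain ⟨l₁, l₂, hr, hle⟩ := exists_ordered_roots U.1 hz
    exact ⟨l₁, l₂, hr, hle, (h l₁ l₂ hr hle).2 hC⟩

theorem mem_eigenvalueSet_iff {U : Hilb 3 →ₗ[ℂ] Hilb 3} (hU : U ∈ unitary _) {z : Hilb 3}
    (hz : ‖z‖ = 1) : inner ℂ z (U z) ∈ eigenvalueSet U ↔ ‖inner ℂ z (U z)‖ = 1 := by
  constructor
  · intro h
    obtain ⟨x, hx⟩ := Module.End.HasEigenvalue.exists_hasEigenvector h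
    exact norm_eq_one_of_mem_unitary hU hx.2 hx.apply_eq_smul
  · intro h
    have h0 : z ≠ 0 := by rintro rfl; simp at hz
    have hUz : ‖U z‖ = 1 := (norm_map_of_mem_unitary hU z).trans hz
    have hUz0 : U z ≠ 0 := by intro h1; simp [h1] at hUz
    have h1 : ‖inner ℂ z (U z) / (‖z‖ * ‖U z‖ : ℂ)‖ = 1 := by simp [hz, hUz, h]
    -- Equality in Cauchy–Schwarz makes U z a multiple of z.
    obtain ⟨-, r, -, hr⟩ := (norm_inner_div_norm_mul_norm_eq_one_iff z (U z)).1 h1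
    have h2 : inner ℂ z (U z) = r := by
      rw [hr, inner_smul_right, inner_self_eq_norm_sq_to_K, hz]
      simp
    rw [h2]
    exact Module.End.hasEigenvalue_of_hasEigenvector ⟨Module.End.mem_eigenspace_iff.2 hr, h0⟩

section Elliptic

variable {U : Hilb 3 →ₗ[ℂ] Hilb 3} {ω l₁ l₂ : ℂ}

theorem mem_finiteEllipticRegion_iff (hi : ω ∈ interior (numRange U) ↔ ‖l₁‖ < 1)
    (h0 : l₂ = 0 ↔ ω = 0) (hle : ‖l₂‖ ≤ ‖l₁‖)
    (hR : ellRatio U ω = (l₁ + l₂) ^ 2 / (l₁ * l₂))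
    (hA : ellAngle U ω = Real.arccos (‖l₁ + l₂‖ / (2 * √(‖l₁‖ * ‖l₂‖)))) :
    ω ∈ finiteEllipticRegion U ↔ ChainType.finiteElliptic.Case l₁ l₂ := by
  change (ω ∈ interior (numRange U) \ {0} ∧ _) ↔ _
  rw [Set.mem_sdiff, hi, Set.mem_singleton_iff, ← h0, hR, hA, ChainType.Case, norm_pos_iff]
  by_cases h2 : l₂ = 0
  · simp [h2]
  have h1 : l₁ ≠ 0 := by
    rintro rfl
    exact h2 (norm_le_zero_iff.1 (by simpa using hle))
  rw [exists_ratio_iff h1 h2]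
  by_cases heq : ‖l₂‖ = ‖l₁‖
  · have := arg_div_eq_zero_iff h1 heq
    rw [arccos_ratio_eq h1 heq, isPiRat_abs_div_two]
    tauto
  · tauto

theorem mem_inftyEllipticRegion_iff (hi : ω ∈ interior (numRange U) ↔ ‖l₁‖ < 1)
    (h0 : l₂ = 0 ↔ ω = 0) (hle : ‖l₂‖ ≤ ‖l₁‖)
    (hR : ellRatio U ω = (l₁ + l₂) ^ 2 / (l₁ * l₂))
    (hA : ellAngle U ω = Real.arccos (‖l₁ + l₂‖ / (2 * √(‖l₁‖ * ‖l₂‖)))) :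
    ω ∈ inftyEllipticRegion U ↔ ChainType.inftyElliptic.Case l₁ l₂ := by
  change (ω ∈ interior (numRange U) \ {0} ∧ _) ↔ _
  rw [Set.mem_sdiff, hi, Set.mem_singleton_iff, ← h0, hR, hA, ChainType.Case, norm_pos_iff]
  by_cases h2 : l₂ = 0
  · simp [h2]
  have h1 : l₁ ≠ 0 := by
    rintro rfl
    exact h2 (norm_le_zero_iff.1 (by simpa using hle))
  constructor
  · rintro ⟨⟨hlt, -⟩, ⟨r, hr0, hr4, hr⟩, hrat⟩
    have heq := ((exists_ratio_iff h1 h2).1 ⟨r, hr0.le, hr4, hr⟩).1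
    rw [arccos_ratio_eq h1 heq, isPiRat_abs_div_two] at hrat
    exact ⟨h2, heq, hlt, hrat⟩
  · rintro ⟨-, heq, hlt, hrat⟩
    -- The phases 0 and π are rational multiples of π; excluding them removes the ratios 4 and 0,
    -- whence the open interval.
    have hne : l₁ ≠ l₂ := by
      rw [Ne, ← arg_div_eq_zero_iff h1 heq]
      intro h
      exact hrat (h ▸ ⟨0, by simp⟩)
    obtain ⟨r, hr0, hr4, hr⟩ := (exists_ratio_iff h1 h2).2 ⟨heq, hne⟩
    refine ⟨⟨hlt, h2⟩, ⟨r, lt_of_le_of_ne hr0 ?_, hr4, hr⟩, ?_⟩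
    · rintro rfl
      have hsum : l₁ + l₂ = 0 := by simpa [h1, h2] using hr
      rw [(arg_div_eq_pi_iff h1 heq).2 hsum] at hrat
      exact hrat ⟨1, by simp⟩
    · rwa [arccos_ratio_eq h1 heq, isPiRat_abs_div_two]

theorem circular_iff (hle : ‖l₂‖ ≤ ‖l₁‖) : ChainType.circular.Case l₁ l₂ ↔
    ChainType.finiteElliptic.Case l₁ l₂ ∧ l₁ + l₂ = 0 := by
  rw [ChainType.Case, ChainType.Case, norm_pos_iff]
  by_cases h2 : l₂ = 0
  · simp [h2]
  have h1 : l₁ ≠ 0 := by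
    rintro rfl
    exact h2 (norm_le_zero_iff.1 (by simpa using hle))
  constructor
  · rintro ⟨-, heq, hlt, harg⟩
    refine ⟨⟨h2, heq, hlt, ?_, ?_⟩, (arg_div_eq_pi_iff h1 heq).1 harg⟩
    · rw [harg]; exact ⟨1, by simp⟩
    · rw [harg]; exact Real.pi_ne_zero
  · rintro ⟨⟨-, heq, hlt, -, -⟩, hsum⟩
    exact ⟨h2, heq, hlt, (arg_div_eq_pi_iff h1 heq).2 hsum⟩

end Elliptic

/-- When 0 < |l₂| = |l₁| < 1, the phase ψ = 0, i.e. l₁ = l₂, is the only one left out by the two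
elliptic types; this is the second alternative of `generic`. -/
theorem generic_iff {l₁ l₂ : ℂ} (hle : ‖l₂‖ ≤ ‖l₁‖) (h1 : ‖l₁‖ ≤ 1) :
    ChainType.generic.Case l₁ l₂ ↔ ¬ (ChainType.unitary.Case l₁ l₂ ∨ l₂ = 0 ∨
      ChainType.taupek.Case l₁ l₂ ∨ ChainType.finiteElliptic.Case l₁ l₂ ∨
      ChainType.inftyElliptic.Case l₁ l₂) := by
  simp only [ChainType.Case, norm_pos_iff]
  by_cases h2 : l₂ = 0
  · simp only [h2, ne_eq, not_true_eq_false, false_and, false_or, true_or, or_true, iff_false]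
    rintro ⟨rfl, h, -⟩
    exact h rfl
  have h10 : l₁ ≠ 0 := by
    rintro rfl
    exact h2 (norm_le_zero_iff.1 (by simpa using hle))
  rcases h1.eq_or_lt with h1 | h1
  · rcases hle.eq_or_lt with h | h
    · simp [h, h1]
    · simp [h2, h1, h1 ▸ h]
  · rcases hle.eq_or_lt with h | h
    · have := arg_div_eq_zero_iff h10 h
      by_cases he : l₁ = l₂
      · have h0 := this.2 he
        have : IsPiRat 0 := ⟨0, by simp⟩
        rw [h0]
        simp [h, h1, h1.ne, h2, he, this]
      · simp [h, h1, h1.ne, h2, he, this]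
    · simp [h2, h, h.ne, h1, h1.ne]

end BallPoint

theorem theorem4p25
    (U : unitary (BallPoint.Hilb 3 →ₗ[ℂ] BallPoint.Hilb 3))
    (z : BallPoint.Hilb 3) (hz : ‖z‖ = 1) (ω : ℂ) (hω : ω = inner ℂ z (U.1 z))
    (F : BallPoint.PIFS (BallPoint.State 3) 2)
    (hF : F = BallPoint.pifs U (BallPoint.ballPointPVM z hz)) :
    (F.GeneratesChain .unitary ↔ ω ∈ BallPoint.eigenvalueSet U.1) ∧
    (F.GeneratesChain .null ↔ ω = 0) ∧
    (F.GeneratesChain .genericNull ↔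
      ω = 0 ∧ BallPoint.IsAcuteNonEquilateral (BallPoint.numRange U.1)) ∧
    (F.GeneratesChain .doubleNull ↔
      ω = 0 ∧ BallPoint.IsEquilateral (BallPoint.numRange U.1)) ∧
    (F.GeneratesChain .taupekNull ↔
      ω = 0 ∧ (BallPoint.IsRightAngled (BallPoint.numRange U.1) ∨
        BallPoint.IsDiameter (BallPoint.numRange U.1))) ∧
    (F.GeneratesChain .taupek ↔ ω ∈ BallPoint.taupekRegion U.1) ∧
    (F.GeneratesChain .finiteElliptic ↔ ω ∈ BallPoint.finiteEllipticRegion U.1) ∧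
    (F.GeneratesChain .circular ↔
      ω ∈ BallPoint.finiteEllipticRegion U.1 ∧ ω = LinearMap.trace ℂ (BallPoint.Hilb 3) U.1) ∧
    (F.GeneratesChain .inftyElliptic ↔ ω ∈ BallPoint.inftyEllipticRegion U.1) ∧
    (F.GeneratesChain .generic ↔
      ¬ (ω ∈ BallPoint.eigenvalueSet U.1 ∨ ω = 0 ∨ ω ∈ BallPoint.taupekRegion U.1 ∨
        ω ∈ BallPoint.finiteEllipticRegion U.1 ∨ ω ∈ BallPoint.inftyEllipticRegion U.1)) := by
  open BallPoint in
  obtain ⟨b, μ, hμ, hb⟩ := exists_orthonormalBasis_of_mem_unitary U.2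
  have hW := numRange_eq_convexHull hb
  have htr := trace_eq_sum_of_diagonal hb
  have hdet := det_eq_prod_of_diagonal hb
  have data : ∀ l₁ l₂ : ℂ, (ballOperator U.1 z).charpoly.roots = {l₁, l₂} →
      SpectralData μ (fun k => ‖inner ℂ (b k) z‖ ^ 2) ω l₁ l₂ := by
    intro l₁ l₂ hr
    obtain ⟨h1, h2⟩ := eigenvalue_relations hμ hb hz hr
    rw [← hω, htr] at h1
    rw [← hω, hdet] at h2
    exact ⟨hμ, fun k => by positivity, by rw [b.sum_sq_norm_inner_right, hz, one_pow],
      hω.trans (inner_map_self_of_diagonal hb z), h1, h2⟩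
  have hun : ∀ l₁ l₂ : ℂ, (ballOperator U.1 z).charpoly.roots = {l₁, l₂} → ‖l₂‖ ≤ ‖l₁‖ →
      (ChainType.unitary.Case l₁ l₂ ↔ ω ∈ eigenvalueSet U.1) := by
    intro l₁ l₂ hr hle
    rw [hω, mem_eigenvalueSet_iff U.2 hz, ← hω]
    exact (data l₁ l₂ hr).norm_eq_one_and_iff hle
  have hnull : ∀ l₁ l₂ : ℂ, (ballOperator U.1 z).charpoly.roots = {l₁, l₂} → ‖l₂‖ ≤ ‖l₁‖ →
      (l₂ = 0 ↔ ω = 0) := fun l₁ l₂ hr hle => (data l₁ l₂ hr).eq_zero_iff hle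
  -- The three null subtypes share this reduction: ω = 0 makes l₂ = 0, leaving a condition on l₁ = ∑
  -- μₖ alone.
  have hnull' : ∀ {C : ℂ → Prop} {E : Prop},
      (∀ l₁, SpectralData μ (fun k => ‖inner ℂ (b k) z‖ ^ 2) 0 l₁ 0 → (C l₁ ↔ E)) →
      ∀ l₁ l₂ : ℂ, (ballOperator U.1 z).charpoly.roots = {l₁, l₂} → ‖l₂‖ ≤ ‖l₁‖ →
      ((l₂ = 0 ∧ C l₁) ↔ (ω = 0 ∧ E)) := by
    intro C E h l₁ l₂ hr hle
    rw [hnull l₁ l₂ hr hle]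
    refine and_congr_right fun h0 => h l₁ ?_
    have hd := data l₁ l₂ hr
    rwa [(hnull l₁ l₂ hr hle).2 h0, h0] at hd
  have htau : ∀ l₁ l₂ : ℂ, (ballOperator U.1 z).charpoly.roots = {l₁, l₂} → ‖l₂‖ ≤ ‖l₁‖ →
      (ChainType.taupek.Case l₁ l₂ ↔ ω ∈ taupekRegion U.1) := by
    intro l₁ l₂ hr hle
    rw [taupekRegion, Set.mem_sdiff, Set.mem_union, Set.mem_singleton_iff, hW,
      (data l₁ l₂ hr).mem_frontier_iff hle, ← hun l₁ l₂ hr hle, ← hnull l₁ l₂ hr hle,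
      ChainType.Case, ChainType.Case, norm_pos_iff, hle.lt_iff_ne]
    constructor
    · rintro ⟨h1, h2, h3⟩
      rw [h3] at h2
      tauto
    · rintro ⟨h1, h2⟩
      rw [h1]
      tauto
  have hrel : ∀ l₁ l₂ : ℂ, (ballOperator U.1 z).charpoly.roots = {l₁, l₂} → ‖l₂‖ ≤ ‖l₁‖ →
      (ω ∈ interior (numRange U.1) ↔ ‖l₁‖ < 1) ∧
      ellRatio U.1 ω = (l₁ + l₂) ^ 2 / (l₁ * l₂) ∧
      ellAngle U.1 ω = Real.arccos (‖l₁ + l₂‖ / (2 * √(‖l₁‖ * ‖l₂‖))) := by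
    intro l₁ l₂ hr hle
    have hd := data l₁ l₂ hr
    refine ⟨by rw [hW, hd.mem_interior_iff_norm_lt_one hle], ?_, ?_⟩
    · rw [ellRatio, htr, hdet, hd.add_eq, hd.mul_eq]
    · rw [ellAngle, htr, hd.add_eq, hd.norm_mul_eq]
  have hfin : ∀ l₁ l₂ : ℂ, (ballOperator U.1 z).charpoly.roots = {l₁, l₂} → ‖l₂‖ ≤ ‖l₁‖ →
      (ChainType.finiteElliptic.Case l₁ l₂ ↔ ω ∈ finiteEllipticRegion U.1) := by
    intro l₁ l₂ hr hle
    obtain ⟨h1, h2, h3⟩ := hrel l₁ l₂ hr hle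
    exact (mem_finiteEllipticRegion_iff h1 (hnull l₁ l₂ hr hle) hle h2 h3).symm
  have hinf : ∀ l₁ l₂ : ℂ, (ballOperator U.1 z).charpoly.roots = {l₁, l₂} → ‖l₂‖ ≤ ‖l₁‖ →
      (ChainType.inftyElliptic.Case l₁ l₂ ↔ ω ∈ inftyEllipticRegion U.1) := by
    intro l₁ l₂ hr hle
    obtain ⟨h1, h2, h3⟩ := hrel l₁ l₂ hr hle
    exact (mem_inftyEllipticRegion_iff h1 (hnull l₁ l₂ hr hle) hle h2 h3).symm
  refine ⟨generatesChain_iff_of_forall hz hF hun, generatesChain_iff_of_forall hz hF hnull,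
    generatesChain_iff_of_forall hz hF (hnull' fun l₁ hd => ?_),
    generatesChain_iff_of_forall hz hF (hnull' fun l₁ hd => ?_),
    generatesChain_iff_of_forall hz hF (hnull' fun l₁ hd => ?_),
    generatesChain_iff_of_forall hz hF htau, generatesChain_iff_of_forall hz hF hfin,
    generatesChain_iff_of_forall hz hF fun l₁ l₂ hr hle => ?_,
    generatesChain_iff_of_forall hz hF hinf,
    generatesChain_iff_of_forall hz hF fun l₁ l₂ hr hle => ?_⟩
  · rw [hW, hd.isAcuteNonEquilateral_iff]
  · rw [hW, hd.isEquilateral_iff]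
  · rw [hW, hd.isRightAngled_or_isDiameter_iff]
  · rw [circular_iff hle, hfin l₁ l₂ hr hle, (data l₁ l₂ hr).add_eq, htr, sub_eq_zero,
      eq_comm (a := ω)]
  · rw [generic_iff hle (data l₁ l₂ hr).norm_le_one, hun l₁ l₂ hr hle, hnull l₁ l₂ hr hle,
      htau l₁ l₂ hr hle, hfin l₁ l₂ hr hle, hinf l₁ l₂ hr hle]
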